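/- Let $\mathbb{K}$ be a field, $A$ a $\mathbb{K}$-algebra, and $(A,\Omega^1,d)$ a first order differential calculus: $\Omega^1$ is an $A$-bimodule and $d:A\to\Omega^1$ is $\mathbb{K}$-linear with $d(ab)=(da)b+a\,db$. Assume that the calculus is surjective, i.e. $\Omega^1$ is spanned by the elements $a\,db$. Write $\Omega^1=\Omega^1_{\mathrm{uni}}/\mathcal N$, where $\Omega^1_{\mathrm{uni}}=\ker(A\otimes_{\mathbb K}A\to A)$ has differential $a\mapsto a\otimes 1-1\otimes a$. Then $\mathcal N$ consists of the $\sum_m r_m\otimes s_m$ with $\sum_m r_ms_m=0$ and $\sum_m(dr_m)s_m=0$. Assume that $\Omega^1$ is pivotal: there is an $A$-bimodule $\mathfrak X^1$ which is both a left and a right dual of $\Omega^1$, with chosen duality bimodule maps $$\mathrm{ev}:\mathfrak X^1\otimes_A\Omega^1\to A,\quad \mathrm{coev}:A\to\Omega^1\otimes_A\mathfrak X^1,\qquad \underline{\mathrm{ev}}:\Omega^1\otimes_A\mathfrak X^1\to A,\quad \underline{\mathrm{coev}}:A\to\mathfrak X^1\otimes_A\Omega^1,$$ each pair satisfying the zigzag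 identities. Write $\mathrm{coev}(1)=\sum_i\omega_i\otimes x'_i$ and $\underline{\mathrm{coev}}(1)=\sum_j y'_j\otimes\rho_j$. The algebra $H\mathfrak X^1$, with product $\bullet$, is the quotient of the free product $A^e\star T_{\mathbb K}\mathfrak X^1\star T_{\mathbb K}(\mathfrak X^1\otimes_{\mathbb K}\Omega^1)\star T_{\mathbb K}(\Omega^1\otimes_{\mathbb K}\mathfrak X^1)$, where $A^e=A\otimes A^{\mathrm{op}}$, with generators $a\overline{b}$, $x$, $(x,\omega)$, $(\omega,x)$, by the two-sided ideal generated by the relations $$a\bullet x=ax,\quad x\bullet a=xa+\mathrm{ev}(x\otimes da),\quad x\bullet\overline a=\overline a\bullet x+(x,da),$$ $$a\overline{a'}\bullet(x,\omega)\bullet b\overline{b'}=(axb,b'\omega a'),\quad a\overline{a'}\bullet(\omega,x)\bullet b\overline{b'}=(a\omega b,b'xa'),$$ $$\sum_i(\omega_i,x)\bullet(x'_i,\omega)=\overline{\underline{\mathrm{ev}}(\omega\otimes x)},\quad \sum_j(x,\rho_j)\bullet(\omega,y'_j)=\mathrm{ev}(x\otimes\omega),$$ $$\sum_j(y'_j,\omega)\bullet(\rho_j,x)=\overline{\mathrm{ev}(x\otimes\omega)},\quad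 \sum_i(\omega,x'_i)\bullet(x,\omega_i)=\underline{\mathrm{ev}}(\omega\otimes x).$$ As an algebra, its isotopy quotient $\mathrm{iso}(H\mathfrak X^1)$ is the quotient of $H\mathfrak X^1$ by the two-sided ideal generated by the elements $a-\overline a$, $a\in A$. Let $A_{\mathrm{ab}}=A/\langle ab-ba\rangle$, and let $\mathfrak Y^1$ be a second copy of the bimodule $\mathfrak X^1$, whose elements are written $\overline x$ as generators. Let $b_i,c_j\in A$ and $x_i,y_j\in\mathfrak X^1$ be any finite families with $\mathrm{coev}(1)=\sum_i db_i\otimes x_i$ and $\underline{\mathrm{coev}}(1)=\sum_j y_j\otimes dc_j$ (these exist because the calculus is surjective). **Proposition.** As an algebra, $\mathrm{iso}(H\mathfrak X^1)$ is isomorphic to the quotient of the free product $A_{\mathrm{ab}}\star T_{\mathbb K}\mathfrak X^1\star T_{\mathbb K}\mathfrak Y^1$ by the two-sided ideal generated by the following relations, for all $a\in A$, all $x,y\in\mathfrak X^1$ and all $\sum_m r_m\otimes s_m\in\mathcal N$ (an element $a\in A$ stands for its class in $A_{\mathrm{ab}}$, and sums over $i$ and $j$ are understood): $$a\bullet x=ax,\qquad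 x\bullet a=xa+\mathrm{ev}(x\otimes da),$$ $$a\bullet\overline y=\overline{ya},\qquad \overline y\bullet a=\overline{ay}+\underline{\mathrm{ev}}(da\otimes y),$$ $$\sum_m s_mxr_m=0=\sum_m\overline{s_mxr_m},$$ $$\overline y\bullet(b_ix_i)-\overline{yb_i}\bullet x_i=\overline y,$$ $$x\bullet\overline{y_jc_j}-(c_jx)\bullet\overline{y_j}=x,$$ $$y_j\bullet(\overline{c_jxa}-\overline{xc_ja})-(ay_j)\bullet(\overline{c_jx}-\overline{xc_j})=ax-xa,$$ $$\overline{x_ia}\bullet(xb_i-b_ix)-\overline{x_i}\bullet(axb_i-ab_ix)=\overline{ax}-\overline{xa}.$$ The isomorphism identifies the classes of $a\in A$ and of $x\in\mathfrak X^1$ on both sides, and it identifies $\overline y$ with the class of $\sum_i(\omega_i,y)\bullet x'_i$. -/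

import Mathlib

open scoped TensorProduct RightActions

universe u

noncomputable section

namespace NCG

/-! ### Bimodules and first order differential calculi

Throughout, an `A`-bimodule is a `K`-vector space with commuting actions of `A` and `Aᵐᵒᵖ` that are
both compatible with the action of `K`; `m <• a` is the right action. -/

section Bimodules

variable (K A : Type u) [Field K] [Ring A] [Algebra K A]
variable (M : Type u) [AddCommGroup M] [Module K M] [Module A M] [Module Aᵐᵒᵖ M]
variable (N : Type u) [AddCommGroup N] [Module K N] [Module A N] [Module Aᵐᵒᵖ N]

/-- The subspace of `M ⊗[K] N` spanned by the elements `m a ⊗ n - m ⊗ a n`. -/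
def balancing : Submodule K (M ⊗[K] N) :=
  Submodule.span K {t | ∃ (m : M) (a : A) (n : N), t = (m <• a) ⊗ₜ[K] n - m ⊗ₜ[K] (a • n)}

/-- The tensor product `M ⊗_A N` of a right and a left module over the noncommutative algebra `A`,
as a `K`-vector space. -/
abbrev BalTensor : Type u := (M ⊗[K] N) ⧸ balancing K A M N

variable {M N}

/-- The class of `m ⊗ n` in `M ⊗_A N`. -/
def btmul (m : M) (n : N) : BalTensor K A M N := (balancing K A M N).mkQ (m ⊗ₜ[K] n)

theorem btmul_balanced (m : M) (a : A) (n : N) :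
    btmul K A (m <• a) n = btmul K A m (a • n) := by
  unfold btmul
  rw [← sub_eq_zero, ← map_sub, Submodule.mkQ_apply, Submodule.Quotient.mk_eq_zero]
  exact Submodule.subset_span ⟨m, a, n, rfl⟩

theorem btmul_sum_left {n : ℕ} (f : Fin n → M) (y : N) :
    btmul K A (∑ i, f i) y = ∑ i, btmul K A (f i) y := by
  simp only [btmul, TensorProduct.sum_tmul, map_sum]

theorem btmul_sum_right {n : ℕ} (x : M) (f : Fin n → N) :
    btmul K A x (∑ i, f i) = ∑ i, btmul K A x (f i) := by
  simp only [btmul, TensorProduct.tmul_sum, map_sum]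

variable (M N)

/-- A duality in the monoidal category of `A`-bimodules, with evaluation `M ⊗_A N → A` and
coevaluation `A → N ⊗_A M`. The evaluation is given as a balanced bilinear map, and the
coevaluation by a representative `∑ i, right i ⊗ left i` of the image of `1`, which determines it;
that this image is central in `N ⊗_A M`, so that `1 ↦ ∑ i, right i ⊗ left i` does extend to a
bimodule map, follows from the two zigzag identities (see `BimoduleDuality.coev_central`). -/
structure BimoduleDuality where
  ev : M →ₗ[K] N →ₗ[K] A
  ev_balanced : ∀ (m : M) (a : A) (n : N), ev (m <• a) n = ev m (a • n)
  ev_left : ∀ (a : A) (m : M) (n : N), ev (a • m) n = a * ev m n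
  ev_right : ∀ (m : M) (n : N) (a : A), ev m (n <• a) = ev m n * a
  size : ℕ
  right : Fin size → N
  left : Fin size → M
  zigzag_left : ∀ m : M, ∑ i, ev m (right i) • left i = m
  zigzag_right : ∀ n : N, ∑ i, right i <• ev (left i) n = n

variable {K A M N}

/-- The element `coev(1)` of `N ⊗_A M`. -/
def BimoduleDuality.coevOne (D : BimoduleDuality K A M N) : BalTensor K A N M :=
  ∑ i, btmul K A (D.right i) (D.left i)

theorem BimoduleDuality.coev_central (D : BimoduleDuality K A M N) (a : A) :
    ∑ i, btmul K A (a • D.right i) (D.left i) = ∑ i, btmul K A (D.right i) (D.left i <• a) := by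
  have h1 : ∀ i, btmul K A (a • D.right i) (D.left i) =
      ∑ k, btmul K A (D.right k) (D.ev (D.left k <• a) (D.right i) • D.left i) := by
    intro i
    conv_lhs => rw [← D.zigzag_right (a • D.right i)]
    rw [btmul_sum_left]
    exact Finset.sum_congr rfl fun k _ => by rw [btmul_balanced, D.ev_balanced]
  simp only [h1]
  rw [Finset.sum_comm]
  refine Finset.sum_congr rfl fun k _ => ?_
  rw [← btmul_sum_right, D.zigzag_left]

end Bimodules

section Calculus

variable (K A : Type u) [Field K] [Ring A] [Algebra K A]
variable (Ω : Type u) [AddCommGroup Ω] [Module K Ω] [Module A Ω] [Module Aᵐᵒᵖ Ω]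
variable (X : Type u) [AddCommGroup X] [Module K X] [Module A X] [Module Aᵐᵒᵖ X]

/-- A first order differential calculus on `A` with bimodule of one-forms `Ω`. -/
structure Calculus where
  d : A →ₗ[K] Ω
  leibniz : ∀ a b : A, d (a * b) = d a <• b + a • d b

/-- A pivotal structure on `Ω`: the bimodule `X` of vector fields is both a left and a right dual
of `Ω`, with chosen duality morphisms. In the notation
`coev(1) = ∑ i, ω i ⊗ x i` and `coev'(1) = ∑ j, y j ⊗ ρ j`, we have
`ω = evl.right`, `x = evl.left`, `y = evr.right`, `ρ = evr.left`. -/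
structure Pivotal where
  evl : BimoduleDuality K A X Ω
  evr : BimoduleDuality K A Ω X

variable {K A Ω}

/-- The calculus is surjective: `Ω` is spanned by the elements `a db`. -/
def Calculus.Surjective (C : Calculus K A Ω) : Prop :=
  Submodule.span K {w : Ω | ∃ a b : A, w = a • C.d b} = ⊤

/-- The linear map `A ⊗ A → Ω`, `r ⊗ s ↦ (dr) s`. Restricted to the universal calculus
`ker (mul : A ⊗ A → A)`, whose differential is `a ↦ a ⊗ 1 - 1 ⊗ a`, it is the unique bimodule map to
`Ω` that commutes with the differentials. -/
def Calculus.fromTensor [IsScalarTower K Aᵐᵒᵖ Ω] (C : Calculus K A Ω) : A ⊗[K] A →ₗ[K] Ω :=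
  TensorProduct.lift <| LinearMap.mk₂ K (fun r s : A => C.d r <• s)
    (fun r r' s => by simp only [map_add, smul_add])
    (fun k r s => by rw [map_smul, smul_comm])
    (fun r s s' => by simp only [MulOpposite.op_add, add_smul])
    (fun k r s => by rw [MulOpposite.op_smul, smul_assoc])

/-- The sub-bimodule `N` of the universal calculus with `Ω = Ω_uni / N`: the kernel of the map from
the universal calculus to `Ω`. -/
def Calculus.kernel [IsScalarTower K Aᵐᵒᵖ Ω] (C : Calculus K A Ω) : Submodule K (A ⊗[K] A) :=
  LinearMap.ker (LinearMap.mul' K A) ⊓ LinearMap.ker C.fromTensor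

end Calculus

/-! ### The algebra of adaptable bimodule connections -/

section HAlgebra

variable (K A : Type u) [Field K] [Ring A] [Algebra K A]
variable (Ω : Type u) [AddCommGroup Ω] [Module K Ω] [Module A Ω] [Module Aᵐᵒᵖ Ω]
variable (X : Type u) [AddCommGroup X] [Module K X] [Module A X] [Module Aᵐᵒᵖ X]

/-- Labels of the four factors of the free product that generates `H𝔛`. -/
inductive HIndex : Type
  | base | vec | vecForm | formVec
  deriving DecidableEq

/-- The four factors: `A^e = A ⊗ Aᵒᵖ` and the tensor algebras of `X`, `X ⊗ Ω` and `Ω ⊗ X`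
over `K`. -/
abbrev HFactor : HIndex → Type u
  | .base => A ⊗[K] Aᵐᵒᵖ
  | .vec => TensorAlgebra K X
  | .vecForm => TensorAlgebra K (X ⊗[K] Ω)
  | .formVec => TensorAlgebra K (Ω ⊗[K] X)

instance HFactor.instRing : ∀ i, Ring (HFactor K A Ω X i)
  | .base => inferInstanceAs (Ring (A ⊗[K] Aᵐᵒᵖ))
  | .vec => inferInstanceAs (Ring (TensorAlgebra K X))
  | .vecForm => inferInstanceAs (Ring (TensorAlgebra K (X ⊗[K] Ω)))
  | .formVec => inferInstanceAs (Ring (TensorAlgebra K (Ω ⊗[K] X)))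

instance HFactor.instAlgebra : ∀ i, Algebra K (HFactor K A Ω X i)
  | .base => inferInstanceAs (Algebra K (A ⊗[K] Aᵐᵒᵖ))
  | .vec => inferInstanceAs (Algebra K (TensorAlgebra K X))
  | .vecForm => inferInstanceAs (Algebra K (TensorAlgebra K (X ⊗[K] Ω)))
  | .formVec => inferInstanceAs (Algebra K (TensorAlgebra K (Ω ⊗[K] X)))

/-- The free product `A^e ⋆ T X ⋆ T (X ⊗ Ω) ⋆ T (Ω ⊗ X)`. -/
abbrev HFree : Type u := LinearAlgebra.FreeProduct K (HFactor K A Ω X)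

namespace HFree

/-- `a ↦ a ⊗ 1`, as a map into the free product. -/
def src : A →ₐ[K] HFree K A Ω X :=
  (LinearAlgebra.FreeProduct.ι K (HFactor K A Ω X) .base).comp
    (Algebra.TensorProduct.includeLeft : A →ₐ[K] A ⊗[K] Aᵐᵒᵖ)

/-- `ā ↦ 1 ⊗ ā`, as a map into the free product. -/
def tgt : Aᵐᵒᵖ →ₐ[K] HFree K A Ω X :=
  (LinearAlgebra.FreeProduct.ι K (HFactor K A Ω X) .base).comp
    (Algebra.TensorProduct.includeRight : Aᵐᵒᵖ →ₐ[K] A ⊗[K] Aᵐᵒᵖ)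

variable {Ω X}

/-- The generator `x`. -/
def vec (x : X) : HFree K A Ω X :=
  LinearAlgebra.FreeProduct.ι K (HFactor K A Ω X) .vec (TensorAlgebra.ι K x)

/-- The generator `(x, ω)`. -/
def vecForm (x : X) (w : Ω) : HFree K A Ω X :=
  LinearAlgebra.FreeProduct.ι K (HFactor K A Ω X) .vecForm (TensorAlgebra.ι K (x ⊗ₜ[K] w))

/-- The generator `(ω, x)`. -/
def formVec (w : Ω) (x : X) : HFree K A Ω X :=
  LinearAlgebra.FreeProduct.ι K (HFactor K A Ω X) .formVec (TensorAlgebra.ι K (w ⊗ₜ[K] x))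

end HFree

variable {K A Ω X}

open HFree MulOpposite in
/-- The defining relations of `H𝔛`. -/
inductive HRel (C : Calculus K A Ω) (P : Pivotal K A Ω X) : HFree K A Ω X → HFree K A Ω X → Prop
  | left_mul (a : A) (x : X) :
      HRel C P (src K A Ω X a * vec K A x) (vec K A (a • x))
  | right_mul (a : A) (x : X) :
      HRel C P (vec K A x * src K A Ω X a) (vec K A (x <• a) + src K A Ω X (P.evl.ev x (C.d a)))
  | bar_mul (a : A) (x : X) :
      HRel C P (vec K A x * tgt K A Ω X (op a))
        (tgt K A Ω X (op a) * vec K A x + vecForm K A x (C.d a))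
  | vecForm_bimod (a a' b b' : A) (x : X) (w : Ω) :
      HRel C P
        (src K A Ω X a * tgt K A Ω X (op a') * vecForm K A x w
          * (src K A Ω X b * tgt K A Ω X (op b')))
        (vecForm K A (a • x <• b) (b' • w <• a'))
  | formVec_bimod (a a' b b' : A) (w : Ω) (x : X) :
      HRel C P
        (src K A Ω X a * tgt K A Ω X (op a') * formVec K A w x
          * (src K A Ω X b * tgt K A Ω X (op b')))
        (formVec K A (a • w <• b) (b' • x <• a'))
  | inv_left (x : X) (w : Ω) :
      HRel C P (∑ i, formVec K A (P.evl.right i) x * vecForm K A (P.evl.left i) w)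
        (tgt K A Ω X (op (P.evr.ev w x)))
  | inv_right (x : X) (w : Ω) :
      HRel C P (∑ j, vecForm K A x (P.evr.left j) * formVec K A w (P.evr.right j))
        (src K A Ω X (P.evl.ev x w))
  | hopf_left (x : X) (w : Ω) :
      HRel C P (∑ j, vecForm K A (P.evr.right j) w * formVec K A (P.evr.left j) x)
        (tgt K A Ω X (op (P.evl.ev x w)))
  | hopf_right (x : X) (w : Ω) :
      HRel C P (∑ i, formVec K A w (P.evl.left i) * vecForm K A x (P.evl.right i))
        (src K A Ω X (P.evr.ev w x))

/-- The algebra `H𝔛` of a first order calculus with a pivotal structure: the quotient of the free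
product by the two-sided ideal that the relations generate. -/
abbrev HAlg (C : Calculus K A Ω) (P : Pivotal K A Ω X) : Type u := RingQuot (HRel C P)

namespace HAlg

variable (C : Calculus K A Ω) (P : Pivotal K A Ω X)

/-- The source map `A → H𝔛`. -/
def source : A →ₐ[K] HAlg C P := (RingQuot.mkAlgHom K (HRel C P)).comp (HFree.src K A Ω X)

/-- The target map `Aᵒᵖ → H𝔛`. -/
def target : Aᵐᵒᵖ →ₐ[K] HAlg C P := (RingQuot.mkAlgHom K (HRel C P)).comp (HFree.tgt K A Ω X)

/-- The class of the generator `x` in `H𝔛`. -/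
def vec (x : X) : HAlg C P := RingQuot.mkAlgHom K (HRel C P) (HFree.vec K A x)

/-- The class of the generator `(x, ω)` in `H𝔛`. -/
def vecForm (x : X) (w : Ω) : HAlg C P :=
  RingQuot.mkAlgHom K (HRel C P) (HFree.vecForm K A x w)

/-- The class of the generator `(ω, x)` in `H𝔛`. -/
def formVec (w : Ω) (x : X) : HAlg C P :=
  RingQuot.mkAlgHom K (HRel C P) (HFree.formVec K A w x)

end HAlg

end HAlgebra

/-! ### Abelianisation and isotopy quotient -/

section Isotopy

variable (K : Type u) [Field K] (A : Type u) [Ring A] [Algebra K A]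

/-- `ab ~ ba`. -/
inductive AbRel : A → A → Prop
  | swap (a b : A) : AbRel (a * b) (b * a)

/-- The abelianisation of `A`: the quotient by the two-sided ideal generated by the elements
`ab - ba`. -/
abbrev Ab : Type u := RingQuot (AbRel A)

/-- The projection of `A` onto its abelianisation. -/
def Ab.mk : A →ₐ[K] Ab A := RingQuot.mkAlgHom K (AbRel A)

variable {K A} {H : Type u} [Ring H] [Algebra K H]

/-- `s(a) ~ t(a)`. -/
inductive IsoRel (s : A →ₐ[K] H) (t : Aᵐᵒᵖ →ₐ[K] H) : H → H → Prop
  | eq (a : A) : IsoRel s t (s a) (t (MulOpposite.op a))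

/-- The total algebra of the isotopy quotient of `(A, H)` with source `s` and target `t`: the
quotient of `H` by the two-sided ideal generated by the elements `s(a) - t(a)`. -/
abbrev IsotopyQuotient (s : A →ₐ[K] H) (t : Aᵐᵒᵖ →ₐ[K] H) : Type u := RingQuot (IsoRel s t)

/-- The projection of `H` onto its isotopy quotient. -/
def IsotopyQuotient.mk (s : A →ₐ[K] H) (t : Aᵐᵒᵖ →ₐ[K] H) : H →ₐ[K] IsotopyQuotient s t :=
  RingQuot.mkAlgHom K (IsoRel s t)

end Isotopy

/-! ### The presentation by generators `A_ab`, `X` and a second copy of `X` -/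

section Presentation

variable (K A : Type u) [Field K] [Ring A] [Algebra K A]
variable (Ω : Type u) [AddCommGroup Ω] [Module K Ω] [Module A Ω] [Module Aᵐᵒᵖ Ω]
variable (X : Type u) [AddCommGroup X] [Module K X] [Module A X] [Module Aᵐᵒᵖ X]

/-- Labels of the three factors of the free product `A_ab ⋆ T X ⋆ T X`. -/
inductive QIndex : Type
  | base | vec | bar
  deriving DecidableEq

/-- The three factors: the abelianisation of `A` and two copies of the tensor algebra of `X`. -/
abbrev QFactor : QIndex → Type u
  | .base => Ab A
  | .vec => TensorAlgebra K X
  | .bar => TensorAlgebra K X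

instance QFactor.instRing : ∀ i, Ring (QFactor K A X i)
  | .base => inferInstanceAs (Ring (Ab A))
  | .vec => inferInstanceAs (Ring (TensorAlgebra K X))
  | .bar => inferInstanceAs (Ring (TensorAlgebra K X))

instance QFactor.instAlgebra : ∀ i, Algebra K (QFactor K A X i)
  | .base => inferInstanceAs (Algebra K (Ab A))
  | .vec => inferInstanceAs (Algebra K (TensorAlgebra K X))
  | .bar => inferInstanceAs (Algebra K (TensorAlgebra K X))

/-- The free product `A_ab ⋆ T X ⋆ T X`. -/
abbrev QFree : Type u := LinearAlgebra.FreeProduct K (QFactor K A X)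

namespace QFree

/-- The inclusion of `A_ab`. -/
def base : Ab A →ₐ[K] QFree K A X := LinearAlgebra.FreeProduct.ι K (QFactor K A X) .base

/-- The image of `a ∈ A`, through its class in `A_ab`. -/
def scal (a : A) : QFree K A X := base K A X (Ab.mk K A a)

variable {X}

/-- The generator `x`. -/
def vec (x : X) : QFree K A X :=
  LinearAlgebra.FreeProduct.ι K (QFactor K A X) .vec (TensorAlgebra.ι K x)

/-- The generator `x̄`, in the second copy of `X`. -/
def bar (x : X) : QFree K A X :=
  LinearAlgebra.FreeProduct.ι K (QFactor K A X) .bar (TensorAlgebra.ι K x)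

end QFree

variable {K A Ω X}

open QFree in
/-- The relations of the presentation of the isotopy quotient, for elements `b i`, `x i`, `y j` and
`c j` with `coev(1) = ∑ i, d (b i) ⊗ x i` and `coev'(1) = ∑ j, y j ⊗ d (c j)`. -/
inductive QRel [IsScalarTower K Aᵐᵒᵖ Ω] (C : Calculus K A Ω) (P : Pivotal K A Ω X)
    {p q : ℕ} (b : Fin p → A) (x : Fin p → X) (y : Fin q → X) (c : Fin q → A) :
    QFree K A X → QFree K A X → Prop
  | left_mul (a : A) (v : X) :
      QRel C P b x y c (scal K A X a * vec K A v) (vec K A (a • v))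
  | right_mul (a : A) (v : X) :
      QRel C P b x y c (vec K A v * scal K A X a)
        (vec K A (v <• a) + scal K A X (P.evl.ev v (C.d a)))
  | bar_left_mul (a : A) (v : X) :
      QRel C P b x y c (scal K A X a * bar K A v) (bar K A (v <• a))
  | bar_right_mul (a : A) (v : X) :
      QRel C P b x y c (bar K A v * scal K A X a)
        (bar K A (a • v) + scal K A X (P.evr.ev (C.d a) v))
  | bim (n : ℕ) (r s : Fin n → A) (_ : ∑ m, r m ⊗ₜ[K] s m ∈ C.kernel) (v : X) :
      QRel C P b x y c (∑ m, vec K A (s m • v <• r m)) 0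
  | bar_bim (n : ℕ) (r s : Fin n → A) (_ : ∑ m, r m ⊗ₜ[K] s m ∈ C.kernel) (v : X) :
      QRel C P b x y c (∑ m, bar K A (s m • v <• r m)) 0
  | inv_left (v : X) :
      QRel C P b x y c
        (∑ i, (bar K A v * vec K A (b i • x i) - bar K A (v <• b i) * vec K A (x i)))
        (bar K A v)
  | inv_right (v : X) :
      QRel C P b x y c
        (∑ j, (vec K A v * bar K A (y j <• c j) - vec K A (c j • v) * bar K A (y j)))
        (vec K A v)
  | hopf_left (a : A) (v : X) :
      QRel C P b x y c
        (∑ j, (vec K A (y j) * (bar K A (c j • v <• a) - bar K A (v <• (c j * a)))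
          - vec K A (a • y j) * (bar K A (c j • v) - bar K A (v <• c j))))
        (vec K A (a • v) - vec K A (v <• a))
  | hopf_right (a : A) (v : X) :
      QRel C P b x y c
        (∑ i, (bar K A (x i <• a) * (vec K A (v <• b i) - vec K A (b i • v))
          - bar K A (x i) * (vec K A (a • v <• b i) - vec K A ((a * b i) • v))))
        (bar K A (a • v) - bar K A (v <• a))

/-- The quotient of `A_ab ⋆ T X ⋆ T X` by the two-sided ideal that the relations generate. -/
abbrev QAlg [IsScalarTower K Aᵐᵒᵖ Ω] (C : Calculus K A Ω) (P : Pivotal K A Ω X)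
    {p q : ℕ} (b : Fin p → A) (x : Fin p → X) (y : Fin q → X) (c : Fin q → A) : Type u :=
  RingQuot (QRel C P b x y c)

/-- The projection of the free product onto the quotient. -/
def QAlg.mk [IsScalarTower K Aᵐᵒᵖ Ω] (C : Calculus K A Ω) (P : Pivotal K A Ω X)
    {p q : ℕ} (b : Fin p → A) (x : Fin p → X) (y : Fin q → X) (c : Fin q → A) :
    QFree K A X →ₐ[K] QAlg C P b x y c :=
  RingQuot.mkAlgHom K (QRel C P b x y c)

end Presentation

end NCG

end

/-! Both algebras classify representations of the calculus in which the image of `A` is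
commutative. In the isotopy quotient the relation `x • ā = ā • x + (x, da)` says that `(x, da)` is
the commutator `[x, a]`, and pairing `(ω, y)` with `coev(1)` gives an element `ȳ` with
`(da, y) = [ȳ, a]`. Since `Ω` is spanned by the forms `(dr) s`, the generators `(x, ω)` and `(ω, y)`
are determined by `A`, `x` and `ȳ`, through `(x, (dr) s) = s [x, r]` and `((dr) s, y) = [ȳ, r] s`.
Conversely, these formulas define linear maps on `Ω` exactly when they respect the relations `𝒩`,
which is the third line of the presentation. Once both pairings are commutators, the four
remaining relations of the presentation are the four invertibility relations of `H𝔛`, evaluated on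
exact forms. -/

noncomputable section

namespace NCG

section Ring

variable {R : Type*} [Ring R] {r s : R}

theorem mul_left_lie_of_commute (h : Commute s r) (z : R) : ⁅s * z, r⁆ = s * ⁅z, r⁆ := by
  rw [Ring.lie_def, Ring.lie_def, mul_sub, mul_assoc, ← mul_assoc r, ← h.eq, mul_assoc]

theorem mul_right_lie_of_commute (h : Commute s r) (z : R) : ⁅z * s, r⁆ = ⁅z, r⁆ * s := by
  rw [Ring.lie_def, Ring.lie_def, sub_mul, mul_assoc, h.eq, mul_assoc, mul_assoc]

theorem add_lie_of_commute (h : Commute s r) (z : R) : ⁅z + s, r⁆ = ⁅z, r⁆ := by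
  rw [Ring.lie_def, Ring.lie_def, add_mul, mul_add, h.eq, add_sub_add_right_eq_sub]

theorem lie_mul_eq_add (z r s : R) : ⁅z, r * s⁆ = ⁅z, r⁆ * s + r * ⁅z, s⁆ := by
  simp only [Ring.lie_def, mul_sub, sub_mul, mul_assoc, sub_add_sub_cancel]

end Ring

section Balanced

variable {K A M N : Type u} [Field K] [Ring A]
  [AddCommGroup M] [Module K M] [Module Aᵐᵒᵖ M] [AddCommGroup N] [Module K N] [Module A N]

theorem sum_eq_of_sum_btmul_eq {V : Type*} [AddCommGroup V] [Module K V] (β : M →ₗ[K] N →ₗ[K] V)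
    (hβ : ∀ (m : M) (a : A) (n : N), β (m <• a) n = β m (a • n)) {p q : ℕ}
    {f : Fin p → M} {g : Fin p → N} {f' : Fin q → M} {g' : Fin q → N}
    (h : ∑ i, btmul K A (f i) (g i) = ∑ j, btmul K A (f' j) (g' j)) :
    ∑ i, β (f i) (g i) = ∑ j, β (f' j) (g' j) := by
  have balancing_le : balancing K A M N ≤ LinearMap.ker (TensorProduct.lift β) := by
    refine Submodule.span_le.2 ?_
    rintro _ ⟨m, a, n, rfl⟩
    simp [hβ]
  simpa [btmul] using congrArg ((balancing K A M N).liftQ (TensorProduct.lift β) balancing_le) h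

end Balanced

namespace Calculus

variable {K A Ω : Type u} [Field K] [Ring A] [Algebra K A]
  [AddCommGroup Ω] [Module K Ω] [Module A Ω] [Module Aᵐᵒᵖ Ω] (C : Calculus K A Ω)

theorem d_one : C.d 1 = 0 := by
  simpa using C.leibniz 1 1

theorem smul_d (a b : A) : a • C.d b = C.d (a * b) - C.d a <• b := by
  rw [C.leibniz, add_sub_cancel_left]

theorem d_op_smul (a b : A) : C.d a <• b = C.d (a * b) - a • C.d b := by
  rw [C.leibniz, add_sub_cancel_right]

variable [IsScalarTower K Aᵐᵒᵖ Ω]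

@[simp]
theorem fromTensor_tmul (r s : A) : C.fromTensor (r ⊗ₜ[K] s) = C.d r <• s := rfl

variable {C}

theorem sum_tmul_mem_kernel_iff {n : ℕ} {r s : Fin n → A} :
    ∑ m, r m ⊗ₜ[K] s m ∈ C.kernel ↔ ∑ m, r m * s m = 0 ∧ ∑ m, C.d (r m) <• s m = 0 := by
  simp [kernel]

namespace Surjective

variable (hC : C.Surjective)
include hC

theorem fromTensor_surjective : Function.Surjective C.fromTensor := by
  rw [← LinearMap.range_eq_top, eq_top_iff, ← hC]
  refine Submodule.span_le.2 ?_
  rintro _ ⟨a, b, rfl⟩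
  exact ⟨(a * b) ⊗ₜ 1 - a ⊗ₜ b, by simp [C.smul_d]⟩

@[elab_as_elim]
theorem induction_d_op_smul {motive : Ω → Prop} (d : ∀ a, motive (C.d a))
    (op_smul : ∀ (a : A) w, motive w → motive (w <• a))
    (add : ∀ w w', motive w → motive w' → motive (w + w')) (w : Ω) : motive w := by
  obtain ⟨t, rfl⟩ := hC.fromTensor_surjective w
  induction t with
  | zero => simpa [C.d_one] using d 1
  | tmul r s => exact op_smul s _ (d r)
  | add t t' ht ht' => rw [map_add]; exact add _ _ ht ht'

@[elab_as_elim]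
theorem induction_smul_d {motive : Ω → Prop} (d : ∀ a, motive (C.d a))
    (smul : ∀ (a : A) w, motive w → motive (a • w))
    (add : ∀ w w', motive w → motive w' → motive (w + w')) (w : Ω) : motive w := by
  obtain ⟨t, rfl⟩ := hC.fromTensor_surjective w
  induction t with
  | zero => simpa [C.d_one] using d 1
  | tmul r s =>
    rw [fromTensor_tmul, C.d_op_smul, sub_eq_add_neg, ← neg_smul]
    exact add _ _ (d _) (smul _ _ (d s))
  | add t t' ht ht' => rw [map_add]; exact add _ _ ht ht'

theorem exists_factor {V : Type*} [AddCommGroup V] [Module K V] (β : A →ₗ[K] A →ₗ[K] V)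
    (one_left : ∀ s, β 1 s = 0)
    (kernel : ∀ (n : ℕ) (r s : Fin n → A), ∑ m, r m ⊗ₜ[K] s m ∈ C.kernel →
      ∑ m, β (r m) (s m) = 0) :
    ∃ F : Ω →ₗ[K] V, ∀ r s, F (C.d r <• s) = β r s := by
  let T := TensorProduct.lift β
  have T_eq_zero : ∀ t ∈ C.kernel, T t = 0 := by
    intro t ht
    obtain ⟨n, r, s, rfl⟩ := TensorProduct.exists_sum_tmul_eq t
    simpa [T] using kernel n r s ht
  have ker_le : LinearMap.ker C.fromTensor ≤ LinearMap.ker T := by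
    intro t ht
    -- Correcting `t` by a multiple of `d 1 = 0` moves it into the universal calculus.
    have hmem : t - 1 ⊗ₜ LinearMap.mul' K A t ∈ C.kernel :=
      ⟨by simp, by simp [LinearMap.mem_ker.1 ht, C.d_one]⟩
    simpa [T, one_left] using T_eq_zero _ hmem
  let e := C.fromTensor.quotKerEquivOfSurjective hC.fromTensor_surjective
  refine ⟨(LinearMap.ker C.fromTensor).liftQ T ker_le ∘ₗ e.symm.toLinearMap, fun r s => ?_⟩
  have symm_apply : e.symm (C.d r <• s) = (LinearMap.ker C.fromTensor).mkQ (r ⊗ₜ s) := by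
    rw [LinearEquiv.symm_apply_eq]
    rfl
  simp [symm_apply, T]

end Surjective

end Calculus

section BimoduleForm

variable {K A L M N : Type u} [Field K] [Ring A] [Algebra K A]
  [AddCommGroup L] [Module K L]
  [AddCommGroup M] [Module K M] [Module A M] [Module Aᵐᵒᵖ M]
  [AddCommGroup N] [Module K N] [Module A N] [Module Aᵐᵒᵖ N]
  {B : Type*} [Ring B] [Algebra K B]

/-- The behaviour of the generators `(x, ω)` and `(ω, x)` under the four actions of `A` once `a` and
`ā` have the same image `σ a`. On the second argument the sides are exchanged, because there it is
`ā` that acts. -/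
structure IsBimoduleForm (σ : A →ₐ[K] B) (Φ : M →ₗ[K] N →ₗ[K] B) : Prop where
  smul_left : ∀ (a : A) m n, Φ (a • m) n = σ a * Φ m n
  op_smul_left : ∀ (a : A) m n, Φ (m <• a) n = Φ m n * σ a
  smul_right : ∀ (a : A) m n, Φ m (a • n) = Φ m n * σ a
  op_smul_right : ∀ (a : A) m n, Φ m (n <• a) = σ a * Φ m n

namespace IsBimoduleForm

variable {σ : A →ₐ[K] B} {Φ : M →ₗ[K] N →ₗ[K] B} (hΦ : IsBimoduleForm σ Φ)
  {p q : ℕ}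
include hΦ

theorem sum_left_mul_congr [Module A L] {ψ : L →ₗ[K] B}
    (hψ : ∀ (a : A) l, ψ (a • l) = σ a * ψ l)
    {f : Fin p → M} {g : Fin p → L} {f' : Fin q → M} {g' : Fin q → L}
    (h : ∑ i, btmul K A (f i) (g i) = ∑ j, btmul K A (f' j) (g' j)) (n : N) :
    ∑ i, Φ (f i) n * ψ (g i) = ∑ j, Φ (f' j) n * ψ (g' j) :=
  sum_eq_of_sum_btmul_eq ((LinearMap.mul K B).compl₁₂ (Φ.flip n) ψ)
    (fun m a l => by simp [hΦ.op_smul_left, hψ, mul_assoc]) h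

theorem sum_right_mul_congr [Module Aᵐᵒᵖ L] {ψ : L →ₗ[K] B}
    (hψ : ∀ (a : A) l, ψ (l <• a) = σ a * ψ l)
    {f : Fin p → L} {g : Fin p → N} {f' : Fin q → L} {g' : Fin q → N}
    (h : ∑ i, btmul K A (f i) (g i) = ∑ j, btmul K A (f' j) (g' j)) (m : M) :
    ∑ i, Φ m (g i) * ψ (f i) = ∑ j, Φ m (g' j) * ψ (f' j) :=
  sum_eq_of_sum_btmul_eq ((LinearMap.mul K B).compl₁₂ (Φ m) ψ).flip
    (fun l a n => by simp [hΦ.smul_right, hψ, mul_assoc]) h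

variable [Module A L] [Module Aᵐᵒᵖ L]

theorem sum_left_mul_ev (D : BimoduleDuality K A L M) {f : Fin p → M} {g : Fin p → L}
    (h : ∑ i, btmul K A (f i) (g i) = D.coevOne) (m : M) (n : N) :
    ∑ i, Φ (f i) n * σ (D.ev (g i) m) = Φ m n := by
  have congr := hΦ.sum_left_mul_congr (ψ := σ.toLinearMap ∘ₗ D.ev.flip m)
    (fun a l => by simp [D.ev_left]) h n
  calc ∑ i, Φ (f i) n * σ (D.ev (g i) m)
      = ∑ i, Φ (D.right i) n * σ (D.ev (D.left i) m) := congr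
    _ = Φ (∑ i, D.right i <• D.ev (D.left i) m) n := by
        simp only [map_sum, LinearMap.sum_apply, hΦ.op_smul_left]
    _ = Φ m n := by rw [D.zigzag_right]

theorem sum_right_mul_ev (hσ : ∀ a b, Commute (σ a) (σ b)) (D : BimoduleDuality K A N L)
    {f : Fin p → L} {g : Fin p → N} (h : ∑ i, btmul K A (f i) (g i) = D.coevOne) (m : M) (n : N) :
    ∑ i, Φ m (g i) * σ (D.ev n (f i)) = Φ m n := by
  have congr := hΦ.sum_right_mul_congr (ψ := σ.toLinearMap ∘ₗ D.ev n)
    (fun a l => by simp [D.ev_right, (hσ a _).eq]) h m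
  calc ∑ i, Φ m (g i) * σ (D.ev n (f i))
      = ∑ i, Φ m (D.left i) * σ (D.ev n (D.right i)) := congr
    _ = Φ m (∑ i, D.ev n (D.right i) • D.left i) := by simp only [map_sum, hΦ.smul_right]
    _ = Φ m n := by rw [D.zigzag_left]

end IsBimoduleForm

end BimoduleForm

section Models

variable {K A Ω X : Type u} [Field K] [Ring A] [Algebra K A]
  [AddCommGroup Ω] [Module K Ω] [Module A Ω] [Module Aᵐᵒᵖ Ω]
  [AddCommGroup X] [Module K X] [Module A X] [Module Aᵐᵒᵖ X]
  {B : Type*} [Ring B] [Algebra K B]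

section Definitions

variable (C : Calculus K A Ω) (P : Pivotal K A Ω X)

/-- Images `σ` of `A` and `u` of the vector fields in an algebra, with commutative image of `A`,
that satisfy the first line of relations of the presentation. -/
structure IsVecModel (σ : A →ₐ[K] B) (u : X →ₗ[K] B) : Prop where
  comm : ∀ a b, Commute (σ a) (σ b)
  left_mul : ∀ a v, σ a * u v = u (a • v)
  right_mul : ∀ a v, u v * σ a = u (v <• a) + σ (P.evl.ev v (C.d a))

/-- A model of `A` and `x`, together with an image `w` of the generators `ȳ` that satisfies the
second line of relations of the presentation. -/
structure IsVecBarModel (σ : A →ₐ[K] B) (u w : X →ₗ[K] B) : Prop extends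
    IsVecModel C P σ u where
  bar_left_mul : ∀ a v, σ a * w v = w (v <• a)
  bar_right_mul : ∀ a v, w v * σ a = w (a • v) + σ (P.evr.ev (C.d a) v)

/-- Images of `A`, `x` and `ȳ` in an algebra that satisfy all the relations of `QAlg`. -/
structure IsPresentationModel [IsScalarTower K Aᵐᵒᵖ Ω] {p q : ℕ} (b : Fin p → A) (x : Fin p → X)
    (y : Fin q → X) (c : Fin q → A) (σ : A →ₐ[K] B) (u w : X →ₗ[K] B) : Prop extends
    IsVecBarModel C P σ u w where
  bim : ∀ (n : ℕ) (r s : Fin n → A), ∑ m, r m ⊗ₜ[K] s m ∈ C.kernel → ∀ v,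
    ∑ m, u (s m • v <• r m) = 0
  bar_bim : ∀ (n : ℕ) (r s : Fin n → A), ∑ m, r m ⊗ₜ[K] s m ∈ C.kernel → ∀ v,
    ∑ m, w (s m • v <• r m) = 0
  inv_left : ∀ v, ∑ i, (w v * u (b i • x i) - w (v <• b i) * u (x i)) = w v
  inv_right : ∀ v, ∑ j, (u v * w (y j <• c j) - u (c j • v) * w (y j)) = u v
  hopf_left : ∀ a v, ∑ j, (u (y j) * (w (c j • v <• a) - w (v <• (c j * a)))
    - u (a • y j) * (w (c j • v) - w (v <• c j))) = u (a • v) - u (v <• a)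
  hopf_right : ∀ a v, ∑ i, (w (x i <• a) * (u (v <• b i) - u (b i • v))
    - w (x i) * (u (a • v <• b i) - u ((a * b i) • v))) = w (a • v) - w (v <• a)

/-- Images of `A`, `x`, `(x, ω)` and `(ω, x)` in an algebra that satisfy the relations of the
isotopy quotient of `H𝔛`, in which `ā = a`. -/
structure IsIsotopyModel (σ : A →ₐ[K] B) (u : X →ₗ[K] B) (F : X →ₗ[K] Ω →ₗ[K] B)
    (G : Ω →ₗ[K] X →ₗ[K] B) : Prop extends IsVecModel C P σ u where
  vecForm : IsBimoduleForm σ F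
  formVec : IsBimoduleForm σ G
  vecForm_d : ∀ v a, F v (C.d a) = ⁅u v, σ a⁆
  inv_left : ∀ v w, ∑ i, G (P.evl.right i) v * F (P.evl.left i) w = σ (P.evr.ev w v)
  inv_right : ∀ v w, ∑ j, F v (P.evr.left j) * G w (P.evr.right j) = σ (P.evl.ev v w)
  hopf_left : ∀ v w, ∑ j, F (P.evr.right j) w * G (P.evr.left j) v = σ (P.evl.ev v w)
  hopf_right : ∀ v w, ∑ i, G w (P.evl.left i) * F v (P.evl.right i) = σ (P.evr.ev w v)

/-- The common refinement of the two kinds of models: `(x, ω)` and `(ω, x)` are represented by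
bimodule forms that are given on exact forms by the commutators with `x` and with `x̄`. -/
structure IsCommutatorModel (σ : A →ₐ[K] B) (u w : X →ₗ[K] B) (F : X →ₗ[K] Ω →ₗ[K] B)
    (G : Ω →ₗ[K] X →ₗ[K] B) : Prop extends IsVecBarModel C P σ u w where
  vecForm : IsBimoduleForm σ F
  formVec : IsBimoduleForm σ G
  vecForm_d : ∀ v a, F v (C.d a) = ⁅u v, σ a⁆
  formVec_d : ∀ a v, G (C.d a) v = ⁅w v, σ a⁆

end Definitions

variable {C : Calculus K A Ω} {P : Pivotal K A Ω X} {σ : A →ₐ[K] B} {u w : X →ₗ[K] B}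
  {F : X →ₗ[K] Ω →ₗ[K] B} {G : Ω →ₗ[K] X →ₗ[K] B}

namespace IsVecModel

variable (h : IsVecModel C P σ u)
include h

theorem lie_vec (v : X) (a : A) : ⁅u v, σ a⁆ = u (v <• a) + σ (P.evl.ev v (C.d a)) - u (a • v) := by
  rw [Ring.lie_def, h.right_mul, h.left_mul]

theorem lie_vec_smul (a : A) (v : X) (r : A) : ⁅u (a • v), σ r⁆ = σ a * ⁅u v, σ r⁆ := by
  rw [← h.left_mul, mul_left_lie_of_commute (h.comm a r)]

theorem lie_vec_op_smul (a : A) (v : X) (r : A) : ⁅u (v <• a), σ r⁆ = ⁅u v, σ r⁆ * σ a := by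
  rw [← mul_right_lie_of_commute (h.comm a r), h.right_mul, add_lie_of_commute (h.comm _ r)]

variable [IsScalarTower K Aᵐᵒᵖ Ω]

theorem sum_mul_lie_vec_of_mem_kernel [SMulCommClass A Aᵐᵒᵖ X] {n : ℕ} {r s : Fin n → A}
    (hrs : ∑ m, r m ⊗ₜ[K] s m ∈ C.kernel) (v : X) :
    ∑ m, σ (s m) * ⁅u v, σ (r m)⁆ = ∑ m, u (s m • v <• r m) := by
  obtain ⟨sum_mul, sum_d⟩ := Calculus.sum_tmul_mem_kernel_iff.1 hrs
  have mul_lie (m : Fin n) : σ (s m) * ⁅u v, σ (r m)⁆ =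
      u (s m • v <• r m) + σ (P.evl.ev v (C.d (r m) <• s m)) - u ((r m * s m) • v) := by
    rw [← h.lie_vec_smul, h.lie_vec, P.evl.ev_left, P.evl.ev_right, map_mul, map_mul,
      (h.comm _ _).eq, mul_smul, smul_comm (s m) (MulOpposite.op (r m))]
  simp only [mul_lie, Finset.sum_sub_distrib, Finset.sum_add_distrib, ← map_sum, ← Finset.sum_smul,
    sum_mul, sum_d, map_zero, zero_smul, add_zero, sub_zero]

theorem exists_vecForm [SMulCommClass A Aᵐᵒᵖ X] (hC : C.Surjective)
    (bim : ∀ (n : ℕ) (r s : Fin n → A), ∑ m, r m ⊗ₜ[K] s m ∈ C.kernel → ∀ v,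
      ∑ m, u (s m • v <• r m) = 0) :
    ∃ F : X →ₗ[K] Ω →ₗ[K] B, ∀ v r s, F v (C.d r <• s) = σ s * ⁅u v, σ r⁆ := by
  let β : A →ₗ[K] A →ₗ[K] X →ₗ[K] B := LinearMap.mk₂ K
    (fun r s => LinearMap.mulLeft K (σ s) ∘ₗ
      (LinearMap.mulRight K (σ r) - LinearMap.mulLeft K (σ r)) ∘ₗ u)
    (fun r r' s => by ext v; simp [mul_add, add_mul, mul_sub]; abel)
    (fun k r s => by ext v; simp [mul_sub, smul_sub])
    (fun r s s' => by ext v; simp [add_mul])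
    (fun k r s => by ext v; simp)
  have β_apply (r s v) : β r s v = σ s * ⁅u v, σ r⁆ := rfl
  obtain ⟨F, hF⟩ := hC.exists_factor β (fun s => by ext v; simp [β_apply, Ring.lie_def])
    (fun n r s hrs => by
      ext v
      simp only [LinearMap.sum_apply, β_apply, h.sum_mul_lie_vec_of_mem_kernel hrs,
        bim n r s hrs, LinearMap.zero_apply])
  exact ⟨F.flip, fun v r s => by rw [LinearMap.flip_apply, hF, β_apply]⟩

theorem isBimoduleForm [SMulCommClass A Aᵐᵒᵖ Ω] (hC : C.Surjective)
    (hF : ∀ v r s, F v (C.d r <• s) = σ s * ⁅u v, σ r⁆) : IsBimoduleForm σ F := by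
  have F_d (v r) : F v (C.d r) = ⁅u v, σ r⁆ := by simpa using hF v r 1
  have F_op_smul (a v ω) : F v (ω <• a) = σ a * F v ω := by
    induction ω using hC.induction_d_op_smul generalizing a with
    | d r => rw [hF, F_d]
    | op_smul s ω ih =>
      rw [← mul_smul, ← MulOpposite.op_mul, ih, ih, map_mul, (h.comm s a).eq, mul_assoc]
    | add ω ω' ih ih' => rw [smul_add, map_add, map_add, ih, ih', mul_add]
  refine ⟨fun a v ω => ?_, fun a v ω => ?_, fun a v ω => ?_, F_op_smul⟩
  · induction ω using hC.induction_d_op_smul with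
    | d r => rw [F_d, F_d, h.lie_vec_smul]
    | op_smul s ω ih => rw [F_op_smul, F_op_smul, ih, ← mul_assoc, (h.comm s a).eq, mul_assoc]
    | add ω ω' ih ih' => rw [map_add, map_add, ih, ih', mul_add]
  · induction ω using hC.induction_d_op_smul with
    | d r => rw [F_d, F_d, h.lie_vec_op_smul]
    | op_smul s ω ih => rw [F_op_smul, F_op_smul, ih, mul_assoc]
    | add ω ω' ih ih' => rw [map_add, map_add, ih, ih', add_mul]
  · induction ω using hC.induction_d_op_smul with
    | d r =>
      rw [C.smul_d, map_sub, F_op_smul, F_d, F_d, F_d, map_mul, (h.comm a r).eq, lie_mul_eq_add,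
        add_sub_cancel_right]
    | op_smul s ω ih => rw [smul_comm, F_op_smul, F_op_smul, ih, mul_assoc]
    | add ω ω' ih ih' => rw [smul_add, map_add, map_add, ih, ih', add_mul]

end IsVecModel

namespace IsVecBarModel

variable (h : IsVecBarModel C P σ u w)
include h

theorem lie_bar (v : X) (a : A) : ⁅w v, σ a⁆ = w (a • v) + σ (P.evr.ev (C.d a) v) - w (v <• a) := by
  rw [Ring.lie_def, h.bar_right_mul, h.bar_left_mul]

theorem lie_bar_op_smul (a : A) (v : X) (r : A) : ⁅w (v <• a), σ r⁆ = σ a * ⁅w v, σ r⁆ := by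
  rw [← h.bar_left_mul, mul_left_lie_of_commute (h.comm a r)]

theorem lie_bar_smul (a : A) (v : X) (r : A) : ⁅w (a • v), σ r⁆ = ⁅w v, σ r⁆ * σ a := by
  rw [← mul_right_lie_of_commute (h.comm a r), h.bar_right_mul, add_lie_of_commute (h.comm _ r)]

variable [IsScalarTower K Aᵐᵒᵖ Ω]

theorem sum_lie_bar_mul_of_mem_kernel [SMulCommClass A Aᵐᵒᵖ X] {n : ℕ} {r s : Fin n → A}
    (hrs : ∑ m, r m ⊗ₜ[K] s m ∈ C.kernel) (v : X) :
    ∑ m, ⁅w v, σ (r m)⁆ * σ (s m) = -∑ m, w (s m • v <• r m) := by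
  obtain ⟨sum_mul, sum_d⟩ := Calculus.sum_tmul_mem_kernel_iff.1 hrs
  have lie_mul (m : Fin n) : ⁅w v, σ (r m)⁆ * σ (s m) =
      w ((r m * s m) • v) + σ (P.evr.ev (C.d (r m) <• s m) v) - w (s m • v <• r m) := by
    rw [← h.lie_bar_smul, h.lie_bar, P.evr.ev_balanced, mul_smul,
      smul_comm (s m) (MulOpposite.op (r m))]
  simp only [lie_mul, Finset.sum_sub_distrib, Finset.sum_add_distrib, ← map_sum, ← Finset.sum_smul,
    ← LinearMap.sum_apply, sum_mul, sum_d, map_zero, zero_smul, LinearMap.zero_apply, add_zero,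
    zero_sub]

theorem exists_formVec [SMulCommClass A Aᵐᵒᵖ X] (hC : C.Surjective)
    (bar_bim : ∀ (n : ℕ) (r s : Fin n → A), ∑ m, r m ⊗ₜ[K] s m ∈ C.kernel → ∀ v,
      ∑ m, w (s m • v <• r m) = 0) :
    ∃ G : Ω →ₗ[K] X →ₗ[K] B, ∀ r s v, G (C.d r <• s) v = ⁅w v, σ r⁆ * σ s := by
  let β : A →ₗ[K] A →ₗ[K] X →ₗ[K] B := LinearMap.mk₂ K
    (fun r s => LinearMap.mulRight K (σ s) ∘ₗ
      (LinearMap.mulRight K (σ r) - LinearMap.mulLeft K (σ r)) ∘ₗ w)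
    (fun r r' s => by ext v; simp [mul_add, add_mul, sub_mul]; abel)
    (fun k r s => by ext v; simp [sub_mul, smul_sub])
    (fun r s s' => by ext v; simp [mul_add])
    (fun k r s => by ext v; simp)
  have β_apply (r s v) : β r s v = ⁅w v, σ r⁆ * σ s := rfl
  obtain ⟨G, hG⟩ := hC.exists_factor β (fun s => by ext v; simp [β_apply, Ring.lie_def])
    (fun n r s hrs => by
      ext v
      simp only [LinearMap.sum_apply, β_apply, h.sum_lie_bar_mul_of_mem_kernel hrs,
        bar_bim n r s hrs, neg_zero, LinearMap.zero_apply])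
  exact ⟨G, fun r s v => by rw [hG, β_apply]⟩

theorem isBimoduleForm [SMulCommClass A Aᵐᵒᵖ Ω] (hC : C.Surjective)
    (hG : ∀ r s v, G (C.d r <• s) v = ⁅w v, σ r⁆ * σ s) : IsBimoduleForm σ G := by
  have G_d (r v) : G (C.d r) v = ⁅w v, σ r⁆ := by simpa using hG r 1 v
  have G_op_smul (a ω v) : G (ω <• a) v = G ω v * σ a := by
    induction ω using hC.induction_d_op_smul generalizing a with
    | d r => rw [hG, G_d]
    | op_smul s ω ih => rw [← mul_smul, ← MulOpposite.op_mul, ih, ih, map_mul, mul_assoc]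
    | add ω ω' ih ih' =>
      rw [smul_add, map_add, map_add, LinearMap.add_apply, LinearMap.add_apply, ih, ih', add_mul]
  refine ⟨fun a ω v => ?_, G_op_smul, fun a ω v => ?_, fun a ω v => ?_⟩
  · induction ω using hC.induction_d_op_smul with
    | d r =>
      rw [C.smul_d, map_sub, LinearMap.sub_apply, G_op_smul, G_d, G_d, G_d, map_mul,
        lie_mul_eq_add, add_sub_cancel_left]
    | op_smul s ω ih => rw [smul_comm, G_op_smul, G_op_smul, ih, mul_assoc]
    | add ω ω' ih ih' =>
      rw [smul_add, map_add, map_add, LinearMap.add_apply, LinearMap.add_apply, ih, ih', mul_add]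
  · induction ω using hC.induction_d_op_smul with
    | d r => rw [G_d, G_d, h.lie_bar_smul]
    | op_smul s ω ih => rw [G_op_smul, G_op_smul, ih, mul_assoc, (h.comm a s).eq, mul_assoc]
    | add ω ω' ih ih' => rw [map_add, LinearMap.add_apply, LinearMap.add_apply, ih, ih', add_mul]
  · induction ω using hC.induction_d_op_smul with
    | d r => rw [G_d, G_d, h.lie_bar_op_smul]
    | op_smul s ω ih => rw [G_op_smul, G_op_smul, ih, mul_assoc]
    | add ω ω' ih ih' => rw [map_add, LinearMap.add_apply, LinearMap.add_apply, ih, ih', mul_add]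

end IsVecBarModel

/-- The image `∑ i, (ω i, y) x' i` of the generator `ȳ`, where `coev(1) = ∑ i, ω i ⊗ x' i`. -/
def Pivotal.bar (P : Pivotal K A Ω X) (u : X →ₗ[K] B) (G : Ω →ₗ[K] X →ₗ[K] B) : X →ₗ[K] B :=
  ∑ i, LinearMap.mulRight K (u (P.evl.left i)) ∘ₗ G (P.evl.right i)

theorem Pivotal.bar_apply (P : Pivotal K A Ω X) (u : X →ₗ[K] B) (G : Ω →ₗ[K] X →ₗ[K] B) (v : X) :
    P.bar u G v = ∑ i, G (P.evl.right i) v * u (P.evl.left i) := by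
  simp [Pivotal.bar]

namespace IsCommutatorModel

section Relations

variable (h : IsCommutatorModel C P σ u w F G) {p q : ℕ} {b : Fin p → A} {x : Fin p → X}
  {y : Fin q → X} {c : Fin q → A}
include h

theorem sum_inv_left_eq (hbx : ∑ i, btmul K A (C.d (b i)) (x i) = P.evl.coevOne) (v : X) :
    ∑ i, (w v * u (b i • x i) - w (v <• b i) * u (x i)) = P.bar u G v := by
  have term_eq (i : Fin p) :
      w v * u (b i • x i) - w (v <• b i) * u (x i) = G (C.d (b i)) v * u (x i) := by
    rw [← h.left_mul, ← h.bar_left_mul, h.formVec_d, Ring.lie_def, sub_mul, mul_assoc (w v)]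
  rw [Finset.sum_congr rfl fun i _ => term_eq i, P.bar_apply]
  exact h.formVec.sum_left_mul_congr (fun a v => (h.left_mul a v).symm) hbx v

theorem sum_inv_right_eq (hyc : ∑ j, btmul K A (y j) (C.d (c j)) = P.evr.coevOne) (v : X) :
    ∑ j, (u v * w (y j <• c j) - u (c j • v) * w (y j)) =
      ∑ j, F v (P.evr.left j) * w (P.evr.right j) := by
  have term_eq (j : Fin q) :
      u v * w (y j <• c j) - u (c j • v) * w (y j) = F v (C.d (c j)) * w (y j) := by
    rw [← h.left_mul, ← h.bar_left_mul, h.vecForm_d, Ring.lie_def, sub_mul, mul_assoc (u v)]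
  rw [Finset.sum_congr rfl fun j _ => term_eq j]
  exact h.vecForm.sum_right_mul_congr (fun a v => (h.bar_left_mul a v).symm) hyc v

theorem sum_hopf_left_eq [SMulCommClass A Aᵐᵒᵖ X]
    (hyc : ∑ j, btmul K A (y j) (C.d (c j)) = P.evr.coevOne) (a : A) (v : X) :
    ∑ j, (u (y j) * (w (c j • v <• a) - w (v <• (c j * a)))
        - u (a • y j) * (w (c j • v) - w (v <• c j))) =
      ∑ j, F (P.evr.right j) (C.d a) * G (P.evr.left j) v - F v (C.d a) := by
  have w_sub (r : A) : w (r • v) - w (v <• r) = G (C.d r) v - σ (P.evr.ev (C.d r) v) := by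
    rw [h.formVec_d, h.lie_bar]
    abel
  have term_eq (j : Fin q) :
      u (y j) * (w (c j • v <• a) - w (v <• (c j * a))) - u (a • y j) * (w (c j • v) - w (v <• c j))
        = F (y j) (C.d a) * G (C.d (c j)) v - F (y j) (C.d a) * σ (P.evr.ev (C.d (c j)) v) := by
    rw [smul_comm, MulOpposite.op_mul, mul_smul, ← h.bar_left_mul, ← h.bar_left_mul, ← mul_sub,
      ← mul_assoc, ← h.left_mul, ← sub_mul, ← Ring.lie_def, ← h.vecForm_d, w_sub, mul_sub]
  rw [Finset.sum_congr rfl fun j _ => term_eq j, Finset.sum_sub_distrib,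
    h.vecForm.sum_left_mul_ev P.evr hyc]
  congr 1
  exact h.vecForm.sum_left_mul_congr (ψ := G.flip v) (fun a ω => h.formVec.smul_left a ω v) hyc _

theorem sum_hopf_right_eq (hbx : ∑ i, btmul K A (C.d (b i)) (x i) = P.evl.coevOne) (a : A) (v : X) :
    ∑ i, (w (x i <• a) * (u (v <• b i) - u (b i • v))
        - w (x i) * (u (a • v <• b i) - u ((a * b i) • v))) =
      G (C.d a) v - ∑ i, G (C.d a) (P.evl.left i) * F v (P.evl.right i) := by
  have u_sub (r : A) : u (v <• r) - u (r • v) = F v (C.d r) - σ (P.evl.ev v (C.d r)) := by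
    rw [h.vecForm_d, h.lie_vec]
    abel
  have term_eq (i : Fin p) :
      w (x i <• a) * (u (v <• b i) - u (b i • v)) - w (x i) * (u (a • v <• b i) - u ((a * b i) • v))
        = G (C.d a) (x i) * σ (P.evl.ev v (C.d (b i))) - G (C.d a) (x i) * F v (C.d (b i)) := by
    rw [mul_smul, ← h.left_mul a, ← h.left_mul a, ← mul_sub (σ a), ← mul_assoc, ← h.bar_left_mul,
      ← sub_mul, ← neg_sub, ← Ring.lie_def, ← h.formVec_d, u_sub, neg_mul, mul_sub, neg_sub]
  rw [Finset.sum_congr rfl fun i _ => term_eq i, Finset.sum_sub_distrib,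
    h.formVec.sum_right_mul_ev h.comm P.evl hbx]
  congr 1
  exact h.formVec.sum_right_mul_congr (fun a ω => h.vecForm.op_smul_right a v ω) hbx _

end Relations

section Extension

variable (h : IsCommutatorModel C P σ u w F G) [IsScalarTower K Aᵐᵒᵖ Ω] (hC : C.Surjective)
include h hC

theorem sum_formVec_mul_vecForm (bar_eq : ∀ v, P.bar u G v = w v) (v : X) (ω : Ω) :
    ∑ i, G (P.evl.right i) v * F (P.evl.left i) ω = σ (P.evr.ev ω v) := by
  induction ω using hC.induction_smul_d with
  | d r =>
    calc ∑ i, G (P.evl.right i) v * F (P.evl.left i) (C.d r)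
        = P.bar u G v * σ r - P.bar u G (r • v) := by
          simp only [h.vecForm_d, Ring.lie_def, P.bar_apply, h.formVec.smul_right, mul_sub,
            Finset.sum_sub_distrib, Finset.sum_mul, mul_assoc]
      _ = σ (P.evr.ev (C.d r) v) := by
          rw [bar_eq, bar_eq, h.bar_right_mul, add_sub_cancel_left]
  | smul a ω ih =>
    simp only [h.vecForm.smul_right, ← mul_assoc, ← Finset.sum_mul, ih, P.evr.ev_left, map_mul,
      (h.comm a _).eq]
  | add ω ω' ih ih' =>
    simp only [map_add, LinearMap.add_apply, mul_add, Finset.sum_add_distrib, ih, ih']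

theorem sum_vecForm_mul_formVec
    (sum_mul_bar : ∀ v, ∑ j, F v (P.evr.left j) * w (P.evr.right j) = u v) (v : X) (ω : Ω) :
    ∑ j, F v (P.evr.left j) * G ω (P.evr.right j) = σ (P.evl.ev v ω) := by
  induction ω using hC.induction_d_op_smul with
  | d r =>
    calc ∑ j, F v (P.evr.left j) * G (C.d r) (P.evr.right j)
        = (∑ j, F v (P.evr.left j) * w (P.evr.right j)) * σ r
            - ∑ j, F (v <• r) (P.evr.left j) * w (P.evr.right j) := by
          simp only [h.formVec_d, Ring.lie_def, h.vecForm.op_smul_left, mul_sub,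
            Finset.sum_sub_distrib, Finset.sum_mul, mul_assoc]
      _ = σ (P.evl.ev v (C.d r)) := by
          rw [sum_mul_bar, sum_mul_bar, h.right_mul, add_sub_cancel_left]
  | op_smul a ω ih =>
    simp only [h.formVec.op_smul_left, ← mul_assoc, ← Finset.sum_mul, ih, P.evl.ev_right, map_mul]
  | add ω ω' ih ih' =>
    simp only [map_add, LinearMap.add_apply, mul_add, Finset.sum_add_distrib, ih, ih']

theorem sum_vecForm_mul_formVec_of_d
    (hopf : ∀ v a, ∑ j, F (P.evr.right j) (C.d a) * G (P.evr.left j) v = σ (P.evl.ev v (C.d a)))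
    (v : X) (ω : Ω) : ∑ j, F (P.evr.right j) ω * G (P.evr.left j) v = σ (P.evl.ev v ω) := by
  induction ω using hC.induction_d_op_smul with
  | d a => exact hopf v a
  | op_smul a ω ih =>
    simp only [h.vecForm.op_smul_right, mul_assoc, ← Finset.mul_sum, ih, P.evl.ev_right, map_mul,
      (h.comm a _).eq]
  | add ω ω' ih ih' => simp only [map_add, add_mul, Finset.sum_add_distrib, ih, ih']

theorem sum_formVec_mul_vecForm_of_d
    (hopf : ∀ v a, ∑ i, G (C.d a) (P.evl.left i) * F v (P.evl.right i) = σ (P.evr.ev (C.d a) v))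
    (v : X) (ω : Ω) : ∑ i, G ω (P.evl.left i) * F v (P.evl.right i) = σ (P.evr.ev ω v) := by
  induction ω using hC.induction_smul_d with
  | d a => exact hopf v a
  | smul a ω ih =>
    simp only [h.formVec.smul_left, mul_assoc, ← Finset.mul_sum, ih, P.evr.ev_left, map_mul]
  | add ω ω' ih ih' =>
    simp only [map_add, LinearMap.add_apply, add_mul, Finset.sum_add_distrib, ih, ih']

theorem isIsotopyModel [SMulCommClass A Aᵐᵒᵖ X] {p q : ℕ} {b : Fin p → A} {x : Fin p → X}
    {y : Fin q → X} {c : Fin q → A} (hbx : ∑ i, btmul K A (C.d (b i)) (x i) = P.evl.coevOne)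
    (hyc : ∑ j, btmul K A (y j) (C.d (c j)) = P.evr.coevOne)
    (hp : IsPresentationModel C P b x y c σ u w) : IsIsotopyModel C P σ u F G where
  toIsVecModel := h.toIsVecModel
  vecForm := h.vecForm
  formVec := h.formVec
  vecForm_d := h.vecForm_d
  inv_left := h.sum_formVec_mul_vecForm hC fun v => by rw [← h.sum_inv_left_eq hbx, hp.inv_left]
  inv_right := h.sum_vecForm_mul_formVec hC fun v => by
    rw [← h.sum_inv_right_eq hyc, hp.inv_right]
  hopf_left := h.sum_vecForm_mul_formVec_of_d hC fun v a => by
    rw [← sub_left_inj (a := F v (C.d a)), ← h.sum_hopf_left_eq hyc, hp.hopf_left, h.vecForm_d,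
      h.lie_vec]
    abel
  hopf_right := h.sum_formVec_mul_vecForm_of_d hC fun v a => by
    rw [← sub_right_inj (a := G (C.d a) v), ← h.sum_hopf_right_eq hbx, hp.hopf_right, h.formVec_d,
      h.lie_bar]
    abel

end Extension

section Map

variable {B' : Type*} [Ring B'] [Algebra K B'] {σ' : A →ₐ[K] B'} {u' w' : X →ₗ[K] B'}
  {F' : X →ₗ[K] Ω →ₗ[K] B'} {G' : Ω →ₗ[K] X →ₗ[K] B'} [IsScalarTower K Aᵐᵒᵖ Ω] {f : B →ₐ[K] B'}
  (h : IsCommutatorModel C P σ u w F G) (h' : IsCommutatorModel C P σ' u' w' F' G')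
  (hC : C.Surjective) (hσ : ∀ a, f (σ a) = σ' a)
include h h' hC hσ

theorem map_vecForm (hu : ∀ v, f (u v) = u' v) (v : X) (ω : Ω) : f (F v ω) = F' v ω := by
  induction ω using hC.induction_d_op_smul with
  | d a => simp only [h.vecForm_d, h'.vecForm_d, Ring.lie_def, map_sub, map_mul, hσ, hu]
  | op_smul a ω ih =>
    rw [h.vecForm.op_smul_right, h'.vecForm.op_smul_right, map_mul, ih, hσ]
  | add ω ω' ih ih' => simp only [map_add, ih, ih']

theorem map_formVec (hw : ∀ v, f (w v) = w' v) (ω : Ω) (v : X) : f (G ω v) = G' ω v := by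
  induction ω using hC.induction_d_op_smul with
  | d a => simp only [h.formVec_d, h'.formVec_d, Ring.lie_def, map_sub, map_mul, hσ, hw]
  | op_smul a ω ih =>
    rw [h.formVec.op_smul_left, h'.formVec.op_smul_left, map_mul, ih, hσ]
  | add ω ω' ih ih' => simp only [map_add, LinearMap.add_apply, ih, ih']

end Map

end IsCommutatorModel

theorem IsPresentationModel.exists_isCommutatorModel [IsScalarTower K Aᵐᵒᵖ Ω]
    [SMulCommClass A Aᵐᵒᵖ Ω] [SMulCommClass A Aᵐᵒᵖ X] {p q : ℕ}
    {b : Fin p → A} {x : Fin p → X} {y : Fin q → X} {c : Fin q → A}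
    (h : IsPresentationModel C P b x y c σ u w) (hC : C.Surjective) :
    ∃ (F : X →ₗ[K] Ω →ₗ[K] B) (G : Ω →ₗ[K] X →ₗ[K] B), IsCommutatorModel C P σ u w F G := by
  obtain ⟨F, hF⟩ := h.exists_vecForm hC h.bim
  obtain ⟨G, hG⟩ := h.exists_formVec hC h.bar_bim
  exact ⟨F, G,
    { toIsVecBarModel := h.toIsVecBarModel
      vecForm := h.toIsVecModel.isBimoduleForm hC hF
      formVec := h.toIsVecBarModel.isBimoduleForm hC hG
      vecForm_d := fun v a => by simpa using hF v a 1
      formVec_d := fun a v => by simpa using hG a 1 v }⟩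

namespace IsIsotopyModel

variable (h : IsIsotopyModel C P σ u F G)
include h

theorem mul_bar (a : A) (v : X) : σ a * P.bar u G v = P.bar u G (v <• a) := by
  simp only [P.bar_apply, h.formVec.op_smul_right, Finset.mul_sum, mul_assoc]

theorem lie_bar (v : X) (a : A) : ⁅P.bar u G v, σ a⁆ = G (C.d a) v := by
  have coev_central : ∑ i, G (a • P.evl.right i) v * u (P.evl.left i) =
      ∑ i, G (P.evl.right i) v * u (P.evl.left i <• a) :=
    h.formVec.sum_left_mul_congr (fun a v => (h.left_mul a v).symm) (P.evl.coev_central a) v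
  rw [Ring.lie_def, sub_eq_iff_eq_add']
  calc P.bar u G v * σ a
      = ∑ i, G (P.evl.right i) v *
          (u (P.evl.left i <• a) + σ (P.evl.ev (P.evl.left i) (C.d a))) := by
        simp only [P.bar_apply, Finset.sum_mul, mul_assoc, h.right_mul]
    _ = ∑ i, G (P.evl.right i) v * u (P.evl.left i <• a) + G (C.d a) v := by
        simp only [mul_add, Finset.sum_add_distrib, h.formVec.sum_left_mul_ev P.evl rfl]
    _ = σ a * P.bar u G v + G (C.d a) v := by
        simp only [← coev_central, h.formVec.smul_left, mul_assoc, ← Finset.mul_sum, ← P.bar_apply]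

theorem bar_mul (a : A) (v : X) :
    P.bar u G v * σ a = P.bar u G (a • v) + σ (P.evr.ev (C.d a) v) := by
  simp only [← h.inv_left, P.bar_apply, Finset.sum_mul, ← Finset.sum_add_distrib,
    h.formVec.smul_right, mul_assoc, ← mul_add, h.vecForm_d, Ring.lie_def, add_sub_cancel]

theorem sum_vecForm_mul_bar (v : X) :
    ∑ j, F v (P.evr.left j) * P.bar u G (P.evr.right j) = u v := by
  calc ∑ j, F v (P.evr.left j) * P.bar u G (P.evr.right j)
      = ∑ i, (∑ j, F v (P.evr.left j) * G (P.evl.right i) (P.evr.right j)) * u (P.evl.left i) := by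
        simp only [P.bar_apply, Finset.mul_sum, Finset.sum_mul, mul_assoc]
        exact Finset.sum_comm
    _ = u (∑ i, P.evl.ev v (P.evl.right i) • P.evl.left i) := by
        simp only [h.inv_right, h.left_mul, map_sum]
    _ = u v := by rw [P.evl.zigzag_left]

theorem isCommutatorModel : IsCommutatorModel C P σ u (P.bar u G) F G where
  toIsVecModel := h.toIsVecModel
  bar_left_mul := h.mul_bar
  bar_right_mul := h.bar_mul
  vecForm := h.vecForm
  formVec := h.formVec
  vecForm_d := h.vecForm_d
  formVec_d a v := (h.lie_bar v a).symm

theorem isPresentationModel [IsScalarTower K Aᵐᵒᵖ Ω] [SMulCommClass A Aᵐᵒᵖ X] {p q : ℕ}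
    {b : Fin p → A} {x : Fin p → X} {y : Fin q → X} {c : Fin q → A}
    (hbx : ∑ i, btmul K A (C.d (b i)) (x i) = P.evl.coevOne)
    (hyc : ∑ j, btmul K A (y j) (C.d (c j)) = P.evr.coevOne) :
    IsPresentationModel C P b x y c σ u (P.bar u G) where
  toIsVecBarModel := h.isCommutatorModel.toIsVecBarModel
  bim n r s hrs v := by
    simp only [← h.sum_mul_lie_vec_of_mem_kernel hrs, ← h.vecForm_d, ← h.vecForm.op_smul_right,
      ← map_sum, (Calculus.sum_tmul_mem_kernel_iff.1 hrs).2, map_zero]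
  bar_bim n r s hrs v := by
    rw [← neg_eq_zero, ← h.isCommutatorModel.sum_lie_bar_mul_of_mem_kernel hrs]
    simp only [h.lie_bar, ← h.formVec.op_smul_left, ← LinearMap.sum_apply, ← map_sum,
      (Calculus.sum_tmul_mem_kernel_iff.1 hrs).2, map_zero, LinearMap.zero_apply]
  inv_left := h.isCommutatorModel.sum_inv_left_eq hbx
  inv_right v := by rw [h.isCommutatorModel.sum_inv_right_eq hyc, h.sum_vecForm_mul_bar]
  hopf_left a v := by
    rw [h.isCommutatorModel.sum_hopf_left_eq hyc, h.hopf_left, h.vecForm_d, h.lie_vec]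
    abel
  hopf_right a v := by
    rw [h.isCommutatorModel.sum_hopf_right_eq hbx, h.hopf_right, ← h.lie_bar,
      h.isCommutatorModel.lie_bar]
    abel

end IsIsotopyModel

end Models

section FreeProduct

open LinearAlgebra

variable {R I : Type*} [CommSemiring R] [DecidableEq I] {A : I → Type*} [∀ i, Semiring (A i)]
  [∀ i, Algebra R (A i)] {B : Type*} [Semiring B] [Algebra R B]

theorem freeProduct_lift_ι (f : ∀ i, A i →ₐ[R] B) (i : I) (a : A i) :
    FreeProduct.lift R A (fun {i} => f i) (FreeProduct.ι R A i a) = f i a :=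
  DFunLike.congr_fun (FreeProduct.lift_comp_ι R A (fun {i} => f i)) a

theorem freeProduct_hom_ext {f g : FreeProduct R A →ₐ[R] B}
    (h : ∀ i, f.comp (FreeProduct.ι R A i) = g.comp (FreeProduct.ι R A i)) : f = g :=
  (FreeProduct.lift R A).symm.injective (funext h)

end FreeProduct

section FreeAlgebras

variable {K A Ω X : Type u} [Field K] [Ring A] [Algebra K A]
  [AddCommGroup Ω] [Module K Ω] [AddCommGroup X] [Module K X]
  {B : Type*} [Ring B] [Algebra K B] (σ : A →ₐ[K] B) (hσ : ∀ a b, Commute (σ a) (σ b))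

variable (X) in
/-- The algebra maps on the factors of `A_ab ⋆ T X ⋆ T X` that extend `σ`, `u` and `w`. -/
def QFactor.hom (u w : X →ₗ[K] B) : ∀ i, QFactor K A X i →ₐ[K] B
  | .base => RingQuot.liftAlgHom K ⟨σ, by rintro _ _ ⟨a, b⟩; simp [(hσ a b).eq]⟩
  | .vec => TensorAlgebra.lift K u
  | .bar => TensorAlgebra.lift K w

namespace QFree

/-- The algebra map on `A_ab ⋆ T X ⋆ T X` with values `σ`, `u` and `w` on the generators. -/
def lift (u w : X →ₗ[K] B) : QFree K A X →ₐ[K] B :=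
  LinearAlgebra.FreeProduct.lift K (QFactor K A X) fun {i} => QFactor.hom X σ hσ u w i

@[simp]
theorem lift_scal (u w : X →ₗ[K] B) (a : A) : lift σ hσ u w (scal K A X a) = σ a :=
  (freeProduct_lift_ι (QFactor.hom X σ hσ u w) .base (Ab.mk K A a)).trans
    (RingQuot.liftAlgHom_mkAlgHom_apply K _ _ _)

@[simp]
theorem lift_vec (u w : X →ₗ[K] B) (v : X) : lift σ hσ u w (vec K A v) = u v :=
  (freeProduct_lift_ι (QFactor.hom X σ hσ u w) .vec (TensorAlgebra.ι K v)).trans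
    (TensorAlgebra.lift_ι_apply _ _)

@[simp]
theorem lift_bar (u w : X →ₗ[K] B) (v : X) : lift σ hσ u w (bar K A v) = w v :=
  (freeProduct_lift_ι (QFactor.hom X σ hσ u w) .bar (TensorAlgebra.ι K v)).trans
    (TensorAlgebra.lift_ι_apply _ _)

theorem hom_ext {f g : QFree K A X →ₐ[K] B}
    (hscal : ∀ a, f (scal K A X a) = g (scal K A X a))
    (hvec : ∀ v, f (vec K A v) = g (vec K A v))
    (hbar : ∀ v, f (bar K A v) = g (bar K A v)) : f = g := by
  refine freeProduct_hom_ext fun i => ?_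
  cases i with
  | base =>
    exact RingQuot.ringQuot_ext' K (f.comp (base K A X)) (g.comp (base K A X)) (AlgHom.ext hscal)
  | vec => exact TensorAlgebra.hom_ext (LinearMap.ext hvec)
  | bar => exact TensorAlgebra.hom_ext (LinearMap.ext hbar)

end QFree

/-- The algebra maps on the factors of `A^e ⋆ T X ⋆ T (X ⊗ Ω) ⋆ T (Ω ⊗ X)` that extend `u`, `F`,
`G` and, on both copies of `A`, the map `σ`. -/
def HFactor.hom (u : X →ₗ[K] B) (F : X →ₗ[K] Ω →ₗ[K] B) (G : Ω →ₗ[K] X →ₗ[K] B) :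
    ∀ i, HFactor K A Ω X i →ₐ[K] B
  | .base => Algebra.TensorProduct.lift σ (AlgHom.fromOpposite σ hσ) fun a b => hσ a b.unop
  | .vec => TensorAlgebra.lift K u
  | .vecForm => TensorAlgebra.lift K (TensorProduct.lift F)
  | .formVec => TensorAlgebra.lift K (TensorProduct.lift G)

namespace HFree

theorem commute_src_tgt (a : A) (a' : Aᵐᵒᵖ) : Commute (src K A Ω X a) (tgt K A Ω X a') :=
  Commute.map (x := a ⊗ₜ[K] (1 : Aᵐᵒᵖ)) (y := (1 : A) ⊗ₜ[K] a') (by simp [commute_iff_eq])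
    (LinearAlgebra.FreeProduct.ι K (HFactor K A Ω X) .base)

/-- The algebra map on `A^e ⋆ T X ⋆ T (X ⊗ Ω) ⋆ T (Ω ⊗ X)` with values `σ`, `u`, `F` and `G` on the
generators, both copies of `A` being sent to `B` by `σ`. -/
def lift (u : X →ₗ[K] B) (F : X →ₗ[K] Ω →ₗ[K] B) (G : Ω →ₗ[K] X →ₗ[K] B) : HFree K A Ω X →ₐ[K] B :=
  LinearAlgebra.FreeProduct.lift K (HFactor K A Ω X) fun {i} => HFactor.hom σ hσ u F G i

variable (u : X →ₗ[K] B) (F : X →ₗ[K] Ω →ₗ[K] B) (G : Ω →ₗ[K] X →ₗ[K] B)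

@[simp]
theorem lift_src (a : A) : lift σ hσ u F G (src K A Ω X a) = σ a := by
  refine (freeProduct_lift_ι (HFactor.hom σ hσ u F G) .base (a ⊗ₜ 1)).trans ?_
  exact (Algebra.TensorProduct.lift_tmul σ (AlgHom.fromOpposite σ hσ)
    (fun a b => hσ a b.unop) a 1).trans (by simp)

@[simp]
theorem lift_tgt (a : Aᵐᵒᵖ) : lift σ hσ u F G (tgt K A Ω X a) = σ a.unop := by
  refine (freeProduct_lift_ι (HFactor.hom σ hσ u F G) .base (1 ⊗ₜ a)).trans ?_
  exact (Algebra.TensorProduct.lift_tmul σ (AlgHom.fromOpposite σ hσ)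
    (fun a b => hσ a b.unop) 1 a).trans (by simp)

@[simp]
theorem lift_vec (v : X) : lift σ hσ u F G (vec K A v) = u v :=
  (freeProduct_lift_ι (HFactor.hom σ hσ u F G) .vec (TensorAlgebra.ι K v)).trans
    (TensorAlgebra.lift_ι_apply _ _)

@[simp]
theorem lift_vecForm (v : X) (ω : Ω) : lift σ hσ u F G (vecForm K A v ω) = F v ω :=
  (freeProduct_lift_ι (HFactor.hom σ hσ u F G) .vecForm (TensorAlgebra.ι K (v ⊗ₜ ω))).trans
    (TensorAlgebra.lift_ι_apply _ _)

@[simp]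
theorem lift_formVec (ω : Ω) (v : X) : lift σ hσ u F G (formVec K A ω v) = G ω v :=
  (freeProduct_lift_ι (HFactor.hom σ hσ u F G) .formVec (TensorAlgebra.ι K (ω ⊗ₜ v))).trans
    (TensorAlgebra.lift_ι_apply _ _)

theorem hom_ext {f g : HFree K A Ω X →ₐ[K] B}
    (hsrc : ∀ a, f (src K A Ω X a) = g (src K A Ω X a))
    (htgt : ∀ a, f (tgt K A Ω X a) = g (tgt K A Ω X a))
    (hvec : ∀ v, f (vec K A v) = g (vec K A v))
    (hvecForm : ∀ v ω, f (vecForm K A v ω) = g (vecForm K A v ω))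
    (hformVec : ∀ ω v, f (formVec K A ω v) = g (formVec K A ω v)) : f = g := by
  refine freeProduct_hom_ext fun i => ?_
  cases i with
  | base => exact Algebra.TensorProduct.ext (AlgHom.ext hsrc) (AlgHom.ext htgt)
  | vec => exact TensorAlgebra.hom_ext (LinearMap.ext hvec)
  | vecForm => exact TensorAlgebra.hom_ext (TensorProduct.ext' hvecForm)
  | formVec => exact TensorAlgebra.hom_ext (TensorProduct.ext' hformVec)

end HFree

end FreeAlgebras

section Presentation

variable {K A Ω X : Type u} [Field K] [Ring A] [Algebra K A]
  [AddCommGroup Ω] [Module K Ω] [Module A Ω] [Module Aᵐᵒᵖ Ω]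
  [AddCommGroup X] [Module K X] [Module A X] [Module Aᵐᵒᵖ X]
  [IsScalarTower K Aᵐᵒᵖ Ω] {B : Type*} [Ring B] [Algebra K B]

namespace QAlg

variable (C : Calculus K A Ω) (P : Pivotal K A Ω X)
  {p q : ℕ} (b : Fin p → A) (x : Fin p → X) (y : Fin q → X) (c : Fin q → A)

/-- The classes of the elements of `A`. -/
def scal : A →ₐ[K] QAlg C P b x y c :=
  (mk C P b x y c).comp ((QFree.base K A X).comp (Ab.mk K A))

/-- The classes of the generators `x`. -/
def vec : X →ₗ[K] QAlg C P b x y c :=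
  ((mk C P b x y c).comp (LinearAlgebra.FreeProduct.ι K (QFactor K A X) .vec)).toLinearMap ∘ₗ
    TensorAlgebra.ι (M := X) K

/-- The classes of the generators `x̄`. -/
def bar : X →ₗ[K] QAlg C P b x y c :=
  ((mk C P b x y c).comp (LinearAlgebra.FreeProduct.ι K (QFactor K A X) .bar)).toLinearMap ∘ₗ
    TensorAlgebra.ι (M := X) K

@[simp]
theorem mk_scal (a : A) : mk C P b x y c (QFree.scal K A X a) = scal C P b x y c a := rfl

@[simp]
theorem mk_vec (v : X) : mk C P b x y c (QFree.vec K A v) = vec C P b x y c v := rfl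

@[simp]
theorem mk_bar (v : X) : mk C P b x y c (QFree.bar K A v) = bar C P b x y c v := rfl

theorem mk_eq_mk {s t : QFree K A X} (h : QRel C P b x y c s t) :
    mk C P b x y c s = mk C P b x y c t :=
  RingQuot.mkAlgHom_rel K h

theorem isPresentationModel : IsPresentationModel (B := QAlg C P b x y c) C P b x y c
    (scal C P b x y c) (vec C P b x y c) (bar C P b x y c) where
  comm a a' := by
    have mk_swap : Ab.mk K A (a * a') = Ab.mk K A (a' * a) := RingQuot.mkAlgHom_rel K (.swap a a')
    simpa [commute_iff_eq, scal] using
      congrArg ((mk C P b x y c).comp (QFree.base K A X)) mk_swap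
  left_mul a v := by simpa using mk_eq_mk C P b x y c (.left_mul a v)
  right_mul a v := by simpa using mk_eq_mk C P b x y c (.right_mul a v)
  bar_left_mul a v := by simpa using mk_eq_mk C P b x y c (.bar_left_mul a v)
  bar_right_mul a v := by simpa using mk_eq_mk C P b x y c (.bar_right_mul a v)
  bim n r s hrs v := by simpa using mk_eq_mk C P b x y c (.bim n r s hrs v)
  bar_bim n r s hrs v := by simpa using mk_eq_mk C P b x y c (.bar_bim n r s hrs v)
  inv_left v := by
    simpa [-Finset.sum_sub_distrib] using mk_eq_mk C P b x y c (.inv_left v)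
  inv_right v := by
    simpa [-Finset.sum_sub_distrib] using mk_eq_mk C P b x y c (.inv_right v)
  hopf_left a v := by
    simpa [-Finset.sum_sub_distrib] using mk_eq_mk C P b x y c (.hopf_left a v)
  hopf_right a v := by
    simpa [-Finset.sum_sub_distrib] using mk_eq_mk C P b x y c (.hopf_right a v)

variable {C P b x y c} {σ : A →ₐ[K] B} {u w : X →ₗ[K] B}

theorem freeLift_eq_of_rel (h : IsPresentationModel C P b x y c σ u w) ⦃s t : QFree K A X⦄
    (hst : QRel C P b x y c s t) : QFree.lift σ h.comm u w s = QFree.lift σ h.comm u w t := by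
  cases hst with
  | left_mul a v => simpa using h.left_mul a v
  | right_mul a v => simpa using h.right_mul a v
  | bar_left_mul a v => simpa using h.bar_left_mul a v
  | bar_right_mul a v => simpa using h.bar_right_mul a v
  | bim n r s hrs v => simpa using h.bim n r s hrs v
  | bar_bim n r s hrs v => simpa using h.bar_bim n r s hrs v
  | inv_left v => simpa using h.inv_left v
  | inv_right v => simpa using h.inv_right v
  | hopf_left a v => simpa using h.hopf_left a v
  | hopf_right a v => simpa using h.hopf_right a v

/-- The algebra map on the presented algebra that is determined by a model of the relations. -/
def lift (h : IsPresentationModel C P b x y c σ u w) : QAlg C P b x y c →ₐ[K] B :=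
  RingQuot.liftAlgHom K ⟨QFree.lift σ h.comm u w, freeLift_eq_of_rel h⟩

section Lift

variable (h : IsPresentationModel C P b x y c σ u w)

@[simp]
theorem lift_scal (a : A) : lift h (scal C P b x y c a) = σ a :=
  (RingQuot.liftAlgHom_mkAlgHom_apply K _ _ _).trans (QFree.lift_scal σ h.comm u w a)

@[simp]
theorem lift_vec (v : X) : lift h (vec C P b x y c v) = u v :=
  (RingQuot.liftAlgHom_mkAlgHom_apply K _ _ _).trans (QFree.lift_vec σ h.comm u w v)

@[simp]
theorem lift_bar (v : X) : lift h (bar C P b x y c v) = w v :=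
  (RingQuot.liftAlgHom_mkAlgHom_apply K _ _ _).trans (QFree.lift_bar σ h.comm u w v)

end Lift

theorem hom_ext {f g : QAlg C P b x y c →ₐ[K] B}
    (hscal : ∀ a, f (scal C P b x y c a) = g (scal C P b x y c a))
    (hvec : ∀ v, f (vec C P b x y c v) = g (vec C P b x y c v))
    (hbar : ∀ v, f (bar C P b x y c v) = g (bar C P b x y c v)) : f = g :=
  RingQuot.ringQuot_ext' K f g (QFree.hom_ext hscal hvec hbar)

end QAlg

end Presentation

section Isotopy

variable {K A Ω X : Type u} [Field K] [Ring A] [Algebra K A]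
  [AddCommGroup Ω] [Module K Ω] [Module A Ω] [Module Aᵐᵒᵖ Ω]
  [AddCommGroup X] [Module K X] [Module A X] [Module Aᵐᵒᵖ X]
  {B : Type*} [Ring B] [Algebra K B]

/-- The isotopy quotient of `H𝔛`. -/
abbrev IsotopyAlg (C : Calculus K A Ω) (P : Pivotal K A Ω X) : Type u :=
  IsotopyQuotient (H := HAlg C P) (HAlg.source C P) (HAlg.target C P)

namespace IsotopyAlg

section Generators

variable (C : Calculus K A Ω) (P : Pivotal K A Ω X)

/-- The projection of the free product onto the isotopy quotient of `H𝔛`. -/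
def mk : HFree K A Ω X →ₐ[K] IsotopyAlg C P :=
  (IsotopyQuotient.mk (H := HAlg C P) (HAlg.source C P) (HAlg.target C P)).comp
    (RingQuot.mkAlgHom K (HRel C P))

theorem mk_eq_mk {s t : HFree K A Ω X} (h : HRel C P s t) : mk C P s = mk C P t := by
  rw [mk, AlgHom.comp_apply, AlgHom.comp_apply, RingQuot.mkAlgHom_rel K h]

/-- The classes of the elements of `A`. -/
def scal : A →ₐ[K] IsotopyAlg C P :=
  (mk C P).comp (HFree.src K A Ω X)

/-- The classes of the generators `x`. -/
def vec : X →ₗ[K] IsotopyAlg C P :=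
  ((mk C P).comp (LinearAlgebra.FreeProduct.ι K (HFactor K A Ω X) .vec)).toLinearMap ∘ₗ
    TensorAlgebra.ι (M := X) K

/-- The classes of the generators `(x, ω)`. -/
def vecForm : X →ₗ[K] Ω →ₗ[K] IsotopyAlg C P :=
  TensorProduct.curry <|
    ((mk C P).comp (LinearAlgebra.FreeProduct.ι K (HFactor K A Ω X) .vecForm)).toLinearMap ∘ₗ
      TensorAlgebra.ι (M := X ⊗[K] Ω) K

/-- The classes of the generators `(ω, x)`. -/
def formVec : Ω →ₗ[K] X →ₗ[K] IsotopyAlg C P :=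
  TensorProduct.curry <|
    ((mk C P).comp (LinearAlgebra.FreeProduct.ι K (HFactor K A Ω X) .formVec)).toLinearMap ∘ₗ
      TensorAlgebra.ι (M := Ω ⊗[K] X) K

@[simp]
theorem mk_src (a : A) : mk C P (HFree.src K A Ω X a) = scal C P a := rfl

@[simp]
theorem mk_tgt (a : Aᵐᵒᵖ) : mk C P (HFree.tgt K A Ω X a) = scal C P a.unop :=
  (RingQuot.mkAlgHom_rel K (IsoRel.eq (H := HAlg C P) (s := HAlg.source C P)
    (t := HAlg.target C P) a.unop)).symm

@[simp]
theorem mk_vec (v : X) : mk C P (HFree.vec K A v) = vec C P v := rfl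

@[simp]
theorem mk_vecForm (v : X) (ω : Ω) : mk C P (HFree.vecForm K A v ω) = vecForm C P v ω := rfl

@[simp]
theorem mk_formVec (ω : Ω) (v : X) : mk C P (HFree.formVec K A ω v) = formVec C P ω v := rfl

theorem isBimoduleForm_vecForm : IsBimoduleForm (scal C P) (vecForm C P) where
  smul_left a v ω := by simpa using (mk_eq_mk C P (.vecForm_bimod a 1 1 1 v ω)).symm
  op_smul_left a v ω := by simpa using (mk_eq_mk C P (.vecForm_bimod 1 1 a 1 v ω)).symm
  smul_right a v ω := by simpa using (mk_eq_mk C P (.vecForm_bimod 1 1 1 a v ω)).symm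
  op_smul_right a v ω := by simpa using (mk_eq_mk C P (.vecForm_bimod 1 a 1 1 v ω)).symm

theorem isBimoduleForm_formVec : IsBimoduleForm (scal C P) (formVec C P) where
  smul_left a ω v := by simpa using (mk_eq_mk C P (.formVec_bimod a 1 1 1 ω v)).symm
  op_smul_left a ω v := by simpa using (mk_eq_mk C P (.formVec_bimod 1 1 a 1 ω v)).symm
  smul_right a ω v := by simpa using (mk_eq_mk C P (.formVec_bimod 1 1 1 a ω v)).symm
  op_smul_right a ω v := by simpa using (mk_eq_mk C P (.formVec_bimod 1 a 1 1 ω v)).symm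

theorem isIsotopyModel :
    IsIsotopyModel (B := IsotopyAlg C P) C P (scal C P) (vec C P) (vecForm C P) (formVec C P) where
  comm a a' := by
    simpa using (HFree.commute_src_tgt (Ω := Ω) (X := X) a (MulOpposite.op a')).map (mk C P)
  left_mul a v := by simpa using mk_eq_mk C P (.left_mul a v)
  right_mul a v := by simpa using mk_eq_mk C P (.right_mul a v)
  vecForm := isBimoduleForm_vecForm C P
  formVec := isBimoduleForm_formVec C P
  vecForm_d v a := by
    rw [Ring.lie_def, eq_sub_iff_add_eq']
    simpa using (mk_eq_mk C P (.bar_mul a v)).symm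
  inv_left v ω := by simpa using mk_eq_mk C P (.inv_left v ω)
  inv_right v ω := by simpa using mk_eq_mk C P (.inv_right v ω)
  hopf_left v ω := by simpa using mk_eq_mk C P (.hopf_left v ω)
  hopf_right v ω := by simpa using mk_eq_mk C P (.hopf_right v ω)

end Generators

variable {C : Calculus K A Ω} {P : Pivotal K A Ω X} {σ : A →ₐ[K] B} {u : X →ₗ[K] B}
  {F : X →ₗ[K] Ω →ₗ[K] B} {G : Ω →ₗ[K] X →ₗ[K] B}

theorem freeLift_eq_of_rel (h : IsIsotopyModel C P σ u F G) ⦃s t : HFree K A Ω X⦄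
    (hst : HRel C P s t) : HFree.lift σ h.comm u F G s = HFree.lift σ h.comm u F G t := by
  cases hst with
  | left_mul a v => simpa using h.left_mul a v
  | right_mul a v => simpa using h.right_mul a v
  | bar_mul a v => simp [h.vecForm_d, Ring.lie_def]
  | vecForm_bimod a a' b b' v ω =>
    simp [h.vecForm.smul_left, h.vecForm.op_smul_left, h.vecForm.smul_right,
      h.vecForm.op_smul_right, mul_assoc, (h.comm b' _).eq]
  | formVec_bimod a a' b b' ω v =>
    simp [h.formVec.smul_left, h.formVec.op_smul_left, h.formVec.smul_right,
      h.formVec.op_smul_right, mul_assoc, (h.comm b' _).eq]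
  | inv_left v ω => simpa using h.inv_left v ω
  | inv_right v ω => simpa using h.inv_right v ω
  | hopf_left v ω => simpa using h.hopf_left v ω
  | hopf_right v ω => simpa using h.hopf_right v ω

/-- The algebra map on `H𝔛` that is determined by a model of the isotopy quotient. -/
def liftHAlg (h : IsIsotopyModel C P σ u F G) : HAlg C P →ₐ[K] B :=
  RingQuot.liftAlgHom K ⟨HFree.lift σ h.comm u F G, freeLift_eq_of_rel h⟩

theorem liftHAlg_mkAlgHom (h : IsIsotopyModel C P σ u F G) (t : HFree K A Ω X) :
    liftHAlg h (RingQuot.mkAlgHom K (HRel C P) t) = HFree.lift σ h.comm u F G t :=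
  RingQuot.liftAlgHom_mkAlgHom_apply K _ _ _

/-- The algebra map on the isotopy quotient of `H𝔛` that is determined by a model. -/
def lift (h : IsIsotopyModel C P σ u F G) : IsotopyAlg C P →ₐ[K] B :=
  RingQuot.liftAlgHom K ⟨liftHAlg h, by
    rintro _ _ ⟨a⟩
    simp [HAlg.source, HAlg.target, liftHAlg_mkAlgHom]⟩

theorem lift_mk (h : IsIsotopyModel C P σ u F G) (t : HFree K A Ω X) :
    lift h (mk C P t) = HFree.lift σ h.comm u F G t :=
  (RingQuot.liftAlgHom_mkAlgHom_apply K _ _ _).trans (liftHAlg_mkAlgHom h t)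

section Lift

variable (h : IsIsotopyModel C P σ u F G)

@[simp]
theorem lift_scal (a : A) : lift h (scal C P a) = σ a :=
  (lift_mk h _).trans (HFree.lift_src σ h.comm u F G a)

@[simp]
theorem lift_vec (v : X) : lift h (vec C P v) = u v :=
  (lift_mk h _).trans (HFree.lift_vec σ h.comm u F G v)

@[simp]
theorem lift_vecForm (v : X) (ω : Ω) : lift h (vecForm C P v ω) = F v ω :=
  (lift_mk h _).trans (HFree.lift_vecForm σ h.comm u F G v ω)

@[simp]
theorem lift_formVec (ω : Ω) (v : X) : lift h (formVec C P ω v) = G ω v :=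
  (lift_mk h _).trans (HFree.lift_formVec σ h.comm u F G ω v)

end Lift

theorem hom_ext {f g : IsotopyAlg C P →ₐ[K] B}
    (hscal : ∀ a, f (scal C P a) = g (scal C P a))
    (hvec : ∀ v, f (vec C P v) = g (vec C P v))
    (hvecForm : ∀ v ω, f (vecForm C P v ω) = g (vecForm C P v ω))
    (hformVec : ∀ ω v, f (formVec C P ω v) = g (formVec C P ω v)) : f = g := by
  have comp_mk_eq : f.comp (mk C P) = g.comp (mk C P) :=
    HFree.hom_ext hscal (fun a => by simpa using hscal a.unop) hvec hvecForm hformVec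
  exact RingQuot.ringQuot_ext' K f g (RingQuot.ringQuot_ext' K _ _ comp_mk_eq)

end IsotopyAlg

end Isotopy

section Equivalence

variable {K A Ω X : Type u} [Field K] [Ring A] [Algebra K A]
  [AddCommGroup Ω] [Module K Ω] [Module A Ω] [Module Aᵐᵒᵖ Ω] [IsScalarTower K Aᵐᵒᵖ Ω]
  [AddCommGroup X] [Module K X] [Module A X] [Module Aᵐᵒᵖ X] [SMulCommClass A Aᵐᵒᵖ X]
  {C : Calculus K A Ω} {P : Pivotal K A Ω X} {p q : ℕ} {b : Fin p → A} {x : Fin p → X}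
  {y : Fin q → X} {c : Fin q → A}

namespace QAlg

section Hom

variable (hbx : ∑ i, btmul K A (C.d (b i)) (x i) = P.evl.coevOne)
  (hyc : ∑ j, btmul K A (y j) (C.d (c j)) = P.evr.coevOne)

/-- The algebra map to the isotopy quotient that sends `ȳ` to the class of `∑ i, (ω i, y) x' i`. -/
def toIsotopyAlg : QAlg C P b x y c →ₐ[K] IsotopyAlg C P :=
  lift ((IsotopyAlg.isIsotopyModel C P).isPresentationModel hbx hyc)

@[simp]
theorem toIsotopyAlg_scal (a : A) :
    toIsotopyAlg hbx hyc (scal C P b x y c a) = IsotopyAlg.scal C P a :=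
  lift_scal _ a

@[simp]
theorem toIsotopyAlg_vec (v : X) :
    toIsotopyAlg hbx hyc (vec C P b x y c v) = IsotopyAlg.vec C P v :=
  lift_vec _ v

@[simp]
theorem toIsotopyAlg_bar (v : X) : toIsotopyAlg hbx hyc (bar C P b x y c v) =
    P.bar (IsotopyAlg.vec C P) (IsotopyAlg.formVec C P) v :=
  lift_bar _ v

end Hom

variable [SMulCommClass A Aᵐᵒᵖ Ω]

theorem toIsotopyAlg_bijective (hC : C.Surjective)
    (hbx : ∑ i, btmul K A (C.d (b i)) (x i) = P.evl.coevOne)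
    (hyc : ∑ j, btmul K A (y j) (C.d (c j)) = P.evr.coevOne) :
    Function.Bijective (toIsotopyAlg hbx hyc : QAlg C P b x y c →ₐ[K] IsotopyAlg C P) := by
  have presentation := isPresentationModel C P b x y c
  obtain ⟨F, G, commutator⟩ := presentation.exists_isCommutatorModel hC
  have isotopy := commutator.isIsotopyModel hC hbx hyc presentation
  have commutator' := (IsotopyAlg.isIsotopyModel C P).isCommutatorModel
  let f := toIsotopyAlg hbx hyc
  let g : IsotopyAlg C P →ₐ[K] QAlg C P b x y c := IsotopyAlg.lift isotopy
  have f_comp_g : f.comp g = AlgHom.id K _ := by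
    have f_vecForm := commutator.map_vecForm commutator' hC
      (toIsotopyAlg_scal hbx hyc) (toIsotopyAlg_vec hbx hyc)
    have f_formVec := commutator.map_formVec commutator' hC
      (toIsotopyAlg_scal hbx hyc) (toIsotopyAlg_bar hbx hyc)
    exact IsotopyAlg.hom_ext (fun a => by simp [f, g]) (fun v => by simp [f, g])
      (fun v ω => by simp [f, g, f_vecForm]) (fun ω v => by simp [f, g, f_formVec])
  have g_comp_f : g.comp f = AlgHom.id K _ := by
    have bar_eq (v : X) : P.bar (vec C P b x y c) G v = bar C P b x y c v := by
      rw [← commutator.sum_inv_left_eq hbx, presentation.inv_left]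
    exact hom_ext (B := QAlg C P b x y c) (fun a => by simp [f, g]) (fun v => by simp [f, g])
      (fun v => by simpa [f, g, P.bar_apply] using bar_eq v)
  exact Function.bijective_iff_has_inverse.2
    ⟨g, DFunLike.congr_fun g_comp_f, DFunLike.congr_fun f_comp_g⟩

end QAlg

end Equivalence

end NCG

end

open NCG in
theorem mainTheorem11 {K A Ω X : Type u} [Field K] [Ring A] [Algebra K A]
    [AddCommGroup Ω] [Module K Ω] [Module A Ω] [Module Aᵐᵒᵖ Ω]
    [IsScalarTower K A Ω] [IsScalarTower K Aᵐᵒᵖ Ω] [SMulCommClass A Aᵐᵒᵖ Ω]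
    [AddCommGroup X] [Module K X] [Module A X] [Module Aᵐᵒᵖ X]
    [IsScalarTower K A X] [IsScalarTower K Aᵐᵒᵖ X] [SMulCommClass A Aᵐᵒᵖ X]
    (C : Calculus K A Ω) (hC : C.Surjective) (P : Pivotal K A Ω X)
    {p q : ℕ} (b : Fin p → A) (x : Fin p → X) (y : Fin q → X) (c : Fin q → A)
    (hbx : ∑ i, btmul K A (C.d (b i)) (x i) = P.evl.coevOne)
    (hyc : ∑ j, btmul K A (y j) (C.d (c j)) = P.evr.coevOne) :
    ∃ φ : QAlg C P b x y c ≃ₐ[K] IsotopyQuotient (HAlg.source C P) (HAlg.target C P),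
      (∀ a : A, φ (QAlg.mk C P b x y c (QFree.base K A X (Ab.mk K A a))) =
        IsotopyQuotient.mk _ _ (HAlg.source C P a)) ∧
      (∀ v : X, φ (QAlg.mk C P b x y c (QFree.vec K A v)) =
        IsotopyQuotient.mk _ _ (HAlg.vec C P v)) ∧
      (∀ v : X, φ (QAlg.mk C P b x y c (QFree.bar K A v)) =
        IsotopyQuotient.mk _ _
          (∑ i, HAlg.formVec C P (P.evl.right i) v * HAlg.vec C P (P.evl.left i))) := by
  refine ⟨AlgEquiv.ofBijective _ (QAlg.toIsotopyAlg_bijective hC hbx hyc),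
    QAlg.toIsotopyAlg_scal hbx hyc, QAlg.toIsotopyAlg_vec hbx hyc, fun v => ?_⟩
  simp only [map_sum, map_mul]
  exact (QAlg.toIsotopyAlg_bar hbx hyc v).trans (P.bar_apply _ _ v)
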